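/- Let $n\ge 3$, $\gamma<\frac{n^2}{4}$, $s\in[0,2]$ and $2^\star(s):=\frac{2(n-s)}{n-2}$. For an open set $U\subset\mathbb{R}^n$ let $D^{1,2}(U)$ be the completion of $C_c^\infty(U)$ for the norm $\left(\int_U|\nabla u|^2\,dx\right)^{1/2}$, realized as a space of functions in $L^{2n/(n-2)}(U)$ with weak gradient in $L^2(U)$; if $U$ is bounded it is also denoted by $H^1_0(U)$. Put $\mathbb{R}^n_+:=\{x\in\mathbb{R}^n:\ x_1>0\}$ and $$\mu_{\gamma,s}(\mathbb{R}^n_+):=\inf\left\{\frac{\int_{\mathbb{R}^n_+}|\nabla u|^2\,dx-\gamma\int_{\mathbb{R}^n_+}\frac{u^2}{|x|^2}\,dx}{\left(\int_{\mathbb{R}^n_+}\frac{|u|^{2^\star(s)}}{|x|^s}\,dx\right)^{2/2^\star(s)}}\ :\ u\in D^{1,2}(\mathbb{R}^n_+)\setminus\{0\}\right\}.$$ Let $\Omega\subset\mathbb{R}^n$ be a bounded domain (open and connected) with $0\in\partial\Omega$, and assume that $\partial\Omega$ is smooth at $0$: there are open neighbourhoods $U,V$ of $0$ and a $C^\infty$-diffeomorphism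 $\varphi:U\to V$ with $\varphi(0)=0$, $\varphi(U\cap\{x_1>0\})=V\cap\Omega$ and $\varphi(U\cap\{x_1=0\})=V\cap\partial\Omega$ (this holds in particular if $\Omega$ is a smooth bounded domain). Then $\mu_{\gamma,s}(\mathbb{R}^n_+)>0$, and for every $\varepsilon>0$ there exists $C_\varepsilon>0$ such that for all $u\in H^1_0(\Omega)$ the integrals $\int_\Omega\frac{|u|^{2^\star(s)}}{|x|^s}\,dx$, $\int_\Omega|\nabla u|^2\,dx$, $\int_\Omega\frac{u^2}{|x|^2}\,dx$ and $\int_\Omega u^2\,dx$ are finite and $$\left(\int_\Omega \frac{|u|^{2^\star(s)}}{|x|^s}\, dx\right)^{\frac{2}{2^\star(s)}}\leq \left(\frac{1}{\mu_{\gamma,s}(\mathbb{R}^n_+)}+\varepsilon\right)\int_\Omega\left(|\nabla u|^2-\gamma\frac{u^2}{|x|^2}\right)\, dx+C_\varepsilon\int_\Omega u^2\, dx.$$ -/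

import Mathlib

open MeasureTheory Filter Topology
open scoped ContDiff

noncomputable section

namespace HardySchrodinger

/-- The open half-space `{x ∈ ℝⁿ : x₁ > 0}` (the first coordinate has index `0`). -/
def halfSpace (n : ℕ) [NeZero n] : Set (EuclideanSpace ℝ (Fin n)) :=
  {x | 0 < x 0}

/-- The critical Hardy-Sobolev exponent `2*(s) = 2 (n - s) / (n - 2)`. -/
def critExp (n : ℕ) (s : ℝ) : ℝ :=
  2 * ((n : ℝ) - s) / ((n : ℝ) - 2)

/-- `φ ∈ C_c^∞(Ω)`. -/
structure IsTestFunction {n : ℕ} (Ω : Set (EuclideanSpace ℝ (Fin n)))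
    (φ : EuclideanSpace ℝ (Fin n) → ℝ) : Prop where
  contDiff : ContDiff ℝ ∞ φ
  hasCompactSupport : HasCompactSupport φ
  tsupport_subset : tsupport φ ⊆ Ω

/-- `G` is the weak (distributional) gradient of `u` on the open set `Ω`. -/
structure HasWeakGradientOn {n : ℕ} (Ω : Set (EuclideanSpace ℝ (Fin n)))
    (u : EuclideanSpace ℝ (Fin n) → ℝ)
    (G : EuclideanSpace ℝ (Fin n) → EuclideanSpace ℝ (Fin n)) : Prop where
  locallyIntegrableOn : LocallyIntegrableOn u Ω
  locallyIntegrableOn_grad : LocallyIntegrableOn G Ω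
  integral_eq : ∀ φ : EuclideanSpace ℝ (Fin n) → ℝ, IsTestFunction Ω φ →
    ∫ x in Ω, u x • gradient φ x = -∫ x in Ω, φ x • G x

/-- `u ∈ D^{1,2}(Ω)`, the completion of `C_c^∞(Ω)` for the norm `‖∇u‖_{L²(Ω)}`, for `n ≥ 3`.
By the Sobolev inequality a sequence in `C_c^∞(Ω)` that is Cauchy for this norm converges in
`L^{2*}(Ω)`, `2* = 2n/(n-2)`, so that the completion is the space of those `u ∈ L^{2*}(Ω)` with a
weak gradient in `L²(Ω)` which are limits of test functions in `L^{2*}(Ω)`, with convergence of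
the gradients in `L²(Ω)`.  If `Ω` is bounded, this is `H¹₀(Ω)`.  Functions are taken up to
equality almost everywhere on `Ω`; their values outside `Ω` play no role. -/
def MemD12 {n : ℕ} (Ω : Set (EuclideanSpace ℝ (Fin n)))
    (u : EuclideanSpace ℝ (Fin n) → ℝ) : Prop :=
  MemLp u (ENNReal.ofReal (critExp n 0)) (volume.restrict Ω) ∧
  ∃ G : EuclideanSpace ℝ (Fin n) → EuclideanSpace ℝ (Fin n),
    HasWeakGradientOn Ω u G ∧ MemLp G 2 (volume.restrict Ω) ∧
    ∃ φ : ℕ → EuclideanSpace ℝ (Fin n) → ℝ,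
      (∀ k, IsTestFunction Ω (φ k)) ∧
      Tendsto (fun k => eLpNorm (fun x => gradient (φ k) x - G x) 2 (volume.restrict Ω))
        atTop (𝓝 0) ∧
      Tendsto (fun k => eLpNorm (fun x => φ k x - u x) (ENNReal.ofReal (critExp n 0))
        (volume.restrict Ω)) atTop (𝓝 0)

/-- `(∫_Ω |u|^{2*(s)} / |x|^s dx)^{2 / 2*(s)}`. -/
def hardySobolevTerm {n : ℕ} (s : ℝ) (Ω : Set (EuclideanSpace ℝ (Fin n)))
    (u : EuclideanSpace ℝ (Fin n) → ℝ) : ℝ :=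
  (∫ x in Ω, |u x| ^ critExp n s / ‖x‖ ^ s) ^ (2 / critExp n s)

/-- The functional `J^Ω_{γ,s}(u)`, where `G` is the weak gradient of `u`. -/
def functionalJ {n : ℕ} (γ s : ℝ) (Ω : Set (EuclideanSpace ℝ (Fin n)))
    (u : EuclideanSpace ℝ (Fin n) → ℝ)
    (G : EuclideanSpace ℝ (Fin n) → EuclideanSpace ℝ (Fin n)) : ℝ :=
  ((∫ x in Ω, ‖G x‖ ^ 2) - γ * ∫ x in Ω, u x ^ 2 / ‖x‖ ^ 2) / hardySobolevTerm s Ω u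

/-- `μ_{γ,s}(Ω) = inf {J^Ω_{γ,s}(u) : u ∈ D^{1,2}(Ω) \ {0}}`. -/
def bestConstant {n : ℕ} (γ s : ℝ) (Ω : Set (EuclideanSpace ℝ (Fin n))) : ℝ :=
  sInf {t : ℝ | ∃ (u : EuclideanSpace ℝ (Fin n) → ℝ)
      (G : EuclideanSpace ℝ (Fin n) → EuclideanSpace ℝ (Fin n)),
    MemD12 Ω u ∧ HasWeakGradientOn Ω u G ∧ ¬ (u =ᵐ[volume.restrict Ω] 0) ∧
      t = functionalJ γ s Ω u G}

/-- The boundary of `Ω` is smooth at `0 ∈ ∂Ω`: there is a `C^∞`-diffeomorphism `φ : U → V` between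
open neighbourhoods of `0` with `φ(0) = 0`, `φ(U ∩ ℝⁿ₊) = V ∩ Ω` and
`φ(U ∩ ∂ℝⁿ₊) = V ∩ ∂Ω`. -/
def SmoothBoundaryAtZero {n : ℕ} [NeZero n] (Ω : Set (EuclideanSpace ℝ (Fin n))) : Prop :=
  ∃ φ : OpenPartialHomeomorph (EuclideanSpace ℝ (Fin n)) (EuclideanSpace ℝ (Fin n)),
    0 ∈ φ.source ∧ φ 0 = 0 ∧
    ContDiffOn ℝ ∞ φ φ.source ∧ ContDiffOn ℝ ∞ φ.symm φ.target ∧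
    φ '' (φ.source ∩ halfSpace n) = φ.target ∩ Ω ∧
    φ '' (φ.source ∩ frontier (halfSpace n)) = φ.target ∩ frontier Ω

end HardySchrodinger

end

/-!
The inequality is proved for test functions and then extended to `D^{1,2}` by density.

**Hardy and Hardy-Sobolev inequalities.** If `F` is a vector field with `div F + |F|² ≤ -c |x|⁻²`,
expanding `|∇u - u F|² ≥ 0` and integrating by parts gives `c ∫ u²/|x|² ≤ ∫ |∇u|²`
(`hardy_of_vectorField`). The field `e₁/x₁ - (n/2) x/|x|²` yields the constant `n²/4` on the
half-space, and `-(n-2)/2 · x/|x|²` a Hardy inequality for every test function supported away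
from `0`. Hölder's inequality between Hardy and Sobolev bounds the Hardy-Sobolev term by the energy
(`exists_hardySobolev`). For `γ < n²/4` this makes the best constant of the half-space positive
(`bestConstant_halfSpace_pos`). Applied to differences of test functions together with Fatou's
lemma, it also shows that all the integrals are continuous along the sequences of test functions
that define `D^{1,2}` (`MemD12.exists_approximation`); here `0 ∉ Ω` is used, which holds because
`Ω` is open and `0 ∈ ∂Ω`.

**Near the origin.** Composing the boundary chart with a linear automorphism of the half-space makes
its derivative at `0` an isometry (`SmoothBoundaryAtZero.exists_isometric_chart`). Transplanting a
test function supported in a small ball to the half-space then changes every integral by a factor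
close to `1`. The error in the energy is absorbed by coercivity, which again comes from the Hardy
constant `n²/4`; so the inequality holds with constant `1/μ + ε` and no lower order term
(`SmoothBoundaryAtZero.exists_local_inequality`).

**Away from the origin.** For `s > 0`, Young's inequality in the Hölder bound produces an
arbitrarily small multiple of the energy plus a multiple of `∫ u²/|x|²`, which is a lower order
term. For `s = 0`, translating a function of `ℝⁿ` to infinity in the half-space shows that `1/μ` is
at least the sharp Sobolev constant (`IsTestFunction.bestConstant_mul_le_of_zero`).

**Globalization.** With `η₁ = sin θ`, `η₂ = cos θ`, where `θ = π/2` near `0` and `θ` has small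
support, `|∇(η₁u)|² + |∇(η₂u)|² = |∇u|² + u² |∇θ|²`, and Minkowski's inequality for
`u² = (η₁u)² + (η₂u)²` in `L^{2*(s)/2}(|x|^{-s} dx)` splits the left-hand side, so that the two
local inequalities add up to the global one.
-/

namespace HardySchrodinger

variable {n : ℕ}

/-! ### Test functions -/

theorem integrable_of_continuousOn_compact {X F : Type*} [TopologicalSpace X] [T2Space X]
    [MeasurableSpace X] [OpensMeasurableSpace X] [SecondCountableTopology X]
    [NormedAddCommGroup F] [SecondCountableTopology F]
    {μ : Measure X} [IsFiniteMeasureOnCompacts μ] {K : Set X} {f : X → F} (hK : IsCompact K)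
    (hf : ContinuousOn f K) (h0 : ∀ x, x ∉ K → f x = 0) : Integrable f μ := by
  have := hf.integrableOn_compact (μ := μ) hK
  rwa [integrableOn_iff_integrable_of_support_subset] at this
  intro x hx
  by_contra hxK
  exact hx (h0 x hxK)

namespace IsTestFunction

variable {W : Set (EuclideanSpace ℝ (Fin n))} {u : EuclideanSpace ℝ (Fin n) → ℝ}

theorem eq_zero_of_notMem (hu : IsTestFunction W u) {x : EuclideanSpace ℝ (Fin n)}
    (hx : x ∉ W) : u x = 0 :=
  image_eq_zero_of_notMem_tsupport fun h => hx (hu.tsupport_subset h)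

theorem mul_left (hu : IsTestFunction W u) {η : EuclideanSpace ℝ (Fin n) → ℝ}
    (hη : ContDiff ℝ ∞ η) : IsTestFunction W fun x => η x * u x :=
  ⟨hη.mul hu.contDiff, hu.hasCompactSupport.mul_left,
    (closure_mono (Function.support_mul_subset_right η u)).trans hu.tsupport_subset⟩

theorem sub {v : EuclideanSpace ℝ (Fin n) → ℝ} (hu : IsTestFunction W u)
    (hv : IsTestFunction W v) : IsTestFunction W fun x => u x - v x :=
  ⟨hu.contDiff.sub hv.contDiff, hu.hasCompactSupport.sub hv.hasCompactSupport,
    (tsupport_sub u v).trans (Set.union_subset hu.tsupport_subset hv.tsupport_subset)⟩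

theorem differentiable (hu : IsTestFunction W u) : Differentiable ℝ u :=
  hu.contDiff.differentiable (by simp)

theorem gradient_eq_zero {x : EuclideanSpace ℝ (Fin n)}
    (hx : x ∉ tsupport u) : gradient u x = 0 := by
  have : fderiv ℝ u x = 0 := by
    by_contra h
    exact hx (support_fderiv_subset ℝ (f := u) h)
  simp [gradient, this]

theorem continuous_gradient (hu : IsTestFunction W u) : Continuous (gradient u) :=
  (InnerProductSpace.toDual ℝ (EuclideanSpace ℝ (Fin n))).symm.continuous.comp
    (hu.contDiff.continuous_fderiv (by simp))

theorem integrable_of_continuousOn {F : Type*} [NormedAddCommGroup F] [SecondCountableTopology F]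
    (hu : IsTestFunction W u) {f : EuclideanSpace ℝ (Fin n) → F}
    (hf : ContinuousOn f (tsupport u)) (h0 : ∀ x, x ∉ tsupport u → f x = 0) : Integrable f :=
  integrable_of_continuousOn_compact hu.hasCompactSupport hf h0

theorem integrable_norm_gradient_sq (hu : IsTestFunction W u) :
    Integrable fun x => ‖gradient u x‖ ^ 2 :=
  hu.integrable_of_continuousOn (hu.continuous_gradient.norm.pow 2).continuousOn
    fun x hx => by simp [gradient_eq_zero hx]

theorem ne_zero_of_mem_tsupport (hu : IsTestFunction W u) (hW : (0 : EuclideanSpace ℝ (Fin n)) ∉ W)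
    {x : EuclideanSpace ℝ (Fin n)} (hx : x ∈ tsupport u) : x ≠ 0 :=
  fun h => hW (h ▸ hu.tsupport_subset hx)

theorem integrable_sq_div (hu : IsTestFunction W u) (hW : (0 : EuclideanSpace ℝ (Fin n)) ∉ W) :
    Integrable fun x => u x ^ 2 / ‖x‖ ^ 2 :=
  hu.integrable_of_continuousOn
    ((hu.contDiff.continuous.pow 2).continuousOn.div (continuous_norm.pow 2).continuousOn
      fun x hx => pow_ne_zero _ (norm_ne_zero_iff.2 (hu.ne_zero_of_mem_tsupport hW hx)))
    fun x hx => by simp [image_eq_zero_of_notMem_tsupport hx]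

theorem integrable_rpow_div (hu : IsTestFunction W u) (hW : (0 : EuclideanSpace ℝ (Fin n)) ∉ W)
    {q : ℝ} (hq : 0 < q) (s : ℝ) :
    Integrable fun x => |u x| ^ q / ‖x‖ ^ s :=
  hu.integrable_of_continuousOn
    ((hu.contDiff.continuous.abs.rpow_const fun _ => Or.inr hq.le).continuousOn.div
      (ContinuousOn.rpow_const continuous_norm.continuousOn fun x hx =>
        Or.inl (norm_ne_zero_iff.2 (hu.ne_zero_of_mem_tsupport hW hx)))
      fun x hx => (Real.rpow_pos_of_pos
        (norm_pos_iff.2 (hu.ne_zero_of_mem_tsupport hW hx)) s).ne')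
    fun x hx => by simp [image_eq_zero_of_notMem_tsupport hx, Real.zero_rpow hq.ne']

theorem integrable_sq (hu : IsTestFunction W u) : Integrable fun x => u x ^ 2 :=
  hu.integrable_of_continuousOn (hu.contDiff.continuous.pow 2).continuousOn
    fun x hx => by simp [image_eq_zero_of_notMem_tsupport hx]

end IsTestFunction

/-! ### Hardy inequalities -/

theorem norm_gradient_sq_eq_sum (u : EuclideanSpace ℝ (Fin n) → ℝ)
    (x : EuclideanSpace ℝ (Fin n)) :
    ‖gradient u x‖ ^ 2 = ∑ i, (fderiv ℝ u x (EuclideanSpace.single i 1)) ^ 2 := by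
  rw [EuclideanSpace.norm_sq_eq]
  refine Finset.sum_congr rfl fun i _ => ?_
  have h : inner ℝ (gradient u x) (EuclideanSpace.single i (1 : ℝ)) = gradient u x i := by
    rw [EuclideanSpace.inner_single_right]; simp
  rw [← h, inner_gradient_left, Real.norm_eq_abs, sq_abs]

/-- A vector field `F` with `div F + |F|² ≤ -c |x|⁻²` on `W` yields a Hardy inequality on `W` with
constant `c`: expand `|∇u - u F|² ≥ 0` and integrate `∇(u²) · F` by parts. -/
theorem hardy_of_vectorField {W : Set (EuclideanSpace ℝ (Fin n))} (hWo : IsOpen W)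
    (hW : (0 : EuclideanSpace ℝ (Fin n)) ∉ W) {u : EuclideanSpace ℝ (Fin n) → ℝ}
    (hu : IsTestFunction W u) (F : Fin n → EuclideanSpace ℝ (Fin n) → ℝ)
    (hF : ∀ i, ContDiffOn ℝ 1 (F i) W) {c : ℝ}
    (hdiv : ∀ x ∈ W, ∑ i, fderiv ℝ (F i) x (EuclideanSpace.single i 1) + ∑ i, (F i x) ^ 2
      ≤ -(c / ‖x‖ ^ 2)) :
    c * ∫ x, u x ^ 2 / ‖x‖ ^ 2 ≤ ∫ x, ‖gradient u x‖ ^ 2 := by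
  have hud := hu.differentiable
  have hcF : ∀ i, ContinuousOn (F i) (tsupport u) :=
    fun i => (hF i).continuousOn.mono hu.tsupport_subset
  have hcF' : ∀ i, ContinuousOn (fun x => fderiv ℝ (F i) x (EuclideanSpace.single i 1))
      (tsupport u) := fun i =>
    (((hF i).continuousOn_fderiv_of_isOpen hWo le_rfl).clm_apply continuousOn_const).mono
      hu.tsupport_subset
  have hcu' : ∀ i, Continuous (fun x => fderiv ℝ u x (EuclideanSpace.single i 1)) := fun i =>
    (hu.contDiff.continuous_fderiv (by simp)).clm_apply continuous_const
  have hcu : Continuous u := hu.contDiff.continuous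
  have hi1 : ∀ i, Integrable fun x => u x ^ 2 * fderiv ℝ (F i) x (EuclideanSpace.single i 1) :=
    fun i => hu.integrable_of_continuousOn ((hcu.pow 2).continuousOn.mul (hcF' i))
      fun x hx => by simp [image_eq_zero_of_notMem_tsupport hx]
  have hi2 : ∀ i, Integrable fun x =>
      2 * u x * fderiv ℝ u x (EuclideanSpace.single i 1) * F i x :=
    fun i => hu.integrable_of_continuousOn
      (((continuous_const.mul hcu).mul (hcu' i)).continuousOn.mul (hcF i))
      fun x hx => by simp [image_eq_zero_of_notMem_tsupport hx]
  have hi3 : ∀ i, Integrable fun x => u x ^ 2 * F i x ^ 2 :=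
    fun i => hu.integrable_of_continuousOn ((hcu.pow 2).continuousOn.mul ((hcF i).pow 2))
      fun x hx => by simp [image_eq_zero_of_notMem_tsupport hx]
  have hi4 : ∀ i, Integrable fun x => u x ^ 2 * F i x :=
    fun i => hu.integrable_of_continuousOn ((hcu.pow 2).continuousOn.mul (hcF i))
      fun x hx => by simp [image_eq_zero_of_notMem_tsupport hx]
  have hfd : ∀ x i, fderiv ℝ (fun y => u y ^ 2) x (EuclideanSpace.single i 1)
      = 2 * u x * fderiv ℝ u x (EuclideanSpace.single i 1) := by
    intro x i
    rw [((hud x).hasFDerivAt.pow 2).fderiv]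
    simp
  have hibp : ∀ i, ∫ x, u x ^ 2 * fderiv ℝ (F i) x (EuclideanSpace.single i 1) =
      -∫ x, 2 * u x * fderiv ℝ u x (EuclideanSpace.single i 1) * F i x := by
    intro i
    have := integral_mul_fderiv_eq_neg_fderiv_mul_of_integrable (μ := volume)
      (f := fun y => u y ^ 2) (g := F i) (v := EuclideanSpace.single i (1 : ℝ))
      (by simpa only [hfd] using hi2 i) (hi1 i) (hi4 i)
      (fun x _ => (hud x).pow 2)
      (fun x hx => ((hF i).contDiffAt (hWo.mem_nhds (hu.tsupport_subset
        (closure_mono (fun y hy => ne_zero_pow two_ne_zero hy) hx)))).differentiableAt one_ne_zero)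
    simpa only [hfd] using this
  have hsum1 : ∫ x, ∑ i, u x ^ 2 * fderiv ℝ (F i) x (EuclideanSpace.single i 1) =
      -∫ x, ∑ i, 2 * u x * fderiv ℝ u x (EuclideanSpace.single i 1) * F i x := by
    rw [integral_finsetSum _ fun i _ => hi1 i, integral_finsetSum _ fun i _ => hi2 i,
      ← Finset.sum_neg_distrib]
    exact Finset.sum_congr rfl fun i _ => hibp i
  have I1 := integrable_finsetSum Finset.univ fun i _ => hi1 i
  have I2 := integrable_finsetSum Finset.univ fun i _ => hi2 i
  have I3 := integrable_finsetSum Finset.univ fun i _ => hi3 i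
  calc c * ∫ x, u x ^ 2 / ‖x‖ ^ 2
      = ∫ x, c * (u x ^ 2 / ‖x‖ ^ 2) := (integral_const_mul _ _).symm
    _ ≤ ∫ x, -((∑ i, u x ^ 2 * fderiv ℝ (F i) x (EuclideanSpace.single i 1)) +
          ∑ i, u x ^ 2 * F i x ^ 2) := by
        refine integral_mono ((hu.integrable_sq_div hW).const_mul c) (I1.add I3).neg fun x => ?_
        simp only
        rw [← Finset.mul_sum, ← Finset.mul_sum, ← mul_add]
        by_cases hx : x ∈ W
        · have := mul_le_mul_of_nonneg_left (hdiv x hx) (sq_nonneg (u x))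
          calc c * (u x ^ 2 / ‖x‖ ^ 2) = -(u x ^ 2 * -(c / ‖x‖ ^ 2)) := by ring
            _ ≤ _ := neg_le_neg this
        · simp [hu.eq_zero_of_notMem hx]
    _ = ∫ x, ((∑ i, 2 * u x * fderiv ℝ u x (EuclideanSpace.single i 1) * F i x) -
          ∑ i, u x ^ 2 * F i x ^ 2) := by
        rw [integral_neg, integral_add I1 I3, integral_sub I2 I3, hsum1]
        ring
    _ ≤ ∫ x, ‖gradient u x‖ ^ 2 := by
        refine integral_mono (I2.sub I3) hu.integrable_norm_gradient_sq fun x => ?_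
        simp only
        rw [norm_gradient_sq_eq_sum, ← Finset.sum_sub_distrib]
        refine Finset.sum_le_sum fun i _ => ?_
        nlinarith [sq_nonneg (fderiv ℝ u x (EuclideanSpace.single i 1) - u x * F i x)]

theorem hasFDerivAt_coord (i : Fin n) (x : EuclideanSpace ℝ (Fin n)) :
    HasFDerivAt (fun y : EuclideanSpace ℝ (Fin n) => y i)
      (EuclideanSpace.proj i : EuclideanSpace ℝ (Fin n) →L[ℝ] ℝ) x :=
  (EuclideanSpace.proj i : EuclideanSpace ℝ (Fin n) →L[ℝ] ℝ).hasFDerivAt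

theorem contDiff_coord (i : Fin n) {k : WithTop ℕ∞} :
    ContDiff ℝ k (fun y : EuclideanSpace ℝ (Fin n) => y i) :=
  (EuclideanSpace.proj i : EuclideanSpace ℝ (Fin n) →L[ℝ] ℝ).contDiff

theorem contDiffOn_coord_div_norm_sq {W : Set (EuclideanSpace ℝ (Fin n))}
    (hW : (0 : EuclideanSpace ℝ (Fin n)) ∉ W) (i : Fin n) :
    ContDiffOn ℝ 1 (fun y : EuclideanSpace ℝ (Fin n) => y i / ‖y‖ ^ 2) W :=
  (contDiff_coord i).contDiffOn.div (contDiff_norm_sq ℝ).contDiffOn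
    fun _ hx => pow_ne_zero _ (norm_ne_zero_iff.2 fun h => hW (h ▸ hx))

theorem hasFDerivAt_coord_div_norm_sq {x : EuclideanSpace ℝ (Fin n)} (hx : x ≠ 0) (i : Fin n) :
    ∃ L : EuclideanSpace ℝ (Fin n) →L[ℝ] ℝ,
      HasFDerivAt (fun y : EuclideanSpace ℝ (Fin n) => y i / ‖y‖ ^ 2) L x ∧
      L (EuclideanSpace.single i 1) = 1 / ‖x‖ ^ 2 - 2 * x i ^ 2 / ‖x‖ ^ 4 := by
  have hx' : ‖x‖ ≠ 0 := norm_ne_zero_iff.2 hx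
  have h2 := (hasFDerivAt_id x).norm_sq
  have h3 := (hasFDerivAt_coord i x).mul
    ((hasDerivAt_inv (pow_ne_zero 2 hx')).comp_hasFDerivAt x h2)
  refine ⟨_, h3.congr_of_eventuallyEq (Eventually.of_forall fun y => div_eq_mul_inv _ _), ?_⟩
  simp [EuclideanSpace.inner_single_right]
  field_simp
  ring

theorem sum_coord_sq (x : EuclideanSpace ℝ (Fin n)) : ∑ i, x i ^ 2 = ‖x‖ ^ 2 := by
  simp [EuclideanSpace.norm_sq_eq]

/-- The Hardy inequality on `ℝⁿ \ {0}`, from the field `-(n-2)/2 · x/|x|²`. -/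
theorem hardy_punctured {W : Set (EuclideanSpace ℝ (Fin n))} (hWo : IsOpen W)
    (hW : (0 : EuclideanSpace ℝ (Fin n)) ∉ W) {u : EuclideanSpace ℝ (Fin n) → ℝ}
    (hu : IsTestFunction W u) :
    ((n : ℝ) - 2) ^ 2 / 4 * ∫ x, u x ^ 2 / ‖x‖ ^ 2 ≤ ∫ x, ‖gradient u x‖ ^ 2 := by
  refine hardy_of_vectorField hWo hW hu
    (fun i x => -(((n : ℝ) - 2) / 2) * (x i / ‖x‖ ^ 2))
    (fun i => contDiffOn_const.mul (contDiffOn_coord_div_norm_sq hW i)) fun x hx => ?_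
  have hx0 : x ≠ 0 := fun h => hW (h ▸ hx)
  have hx' : ‖x‖ ≠ 0 := norm_ne_zero_iff.2 hx0
  choose L hL hL' using fun i => hasFDerivAt_coord_div_norm_sq hx0 i
  have hd : ∀ i, fderiv ℝ (fun x : EuclideanSpace ℝ (Fin n) =>
      -(((n : ℝ) - 2) / 2) * (x i / ‖x‖ ^ 2)) x (EuclideanSpace.single i 1)
      = -(((n : ℝ) - 2) / 2) * (1 / ‖x‖ ^ 2 - 2 * x i ^ 2 / ‖x‖ ^ 4) := by
    intro i
    rw [((hL i).const_mul _).fderiv]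
    simp [hL']
  have hs := sum_coord_sq x
  simp only [hd, mul_pow, div_pow, ← Finset.mul_sum, Finset.sum_sub_distrib, ← Finset.sum_div, hs]
  refine le_of_eq ?_
  simp
  field_simp
  ring

theorem isOpen_halfSpace [NeZero n] : IsOpen (halfSpace n) :=
  isOpen_lt continuous_const (contDiff_coord (k := 0) 0).continuous

theorem zero_notMem_halfSpace [NeZero n] : (0 : EuclideanSpace ℝ (Fin n)) ∉ halfSpace n := by
  simp [halfSpace]

/-- The sharp Hardy inequality on the half-space, from the logarithmic gradient
`e₁/x₁ - (n/2) x/|x|²` of the positive solution `x₁ |x|^(-n/2)` of `-ΔΦ = (n²/4) |x|⁻² Φ`. -/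
theorem hardy_halfSpace [NeZero n] {u : EuclideanSpace ℝ (Fin n) → ℝ}
    (hu : IsTestFunction (halfSpace n) u) :
    (n : ℝ) ^ 2 / 4 * ∫ x, u x ^ 2 / ‖x‖ ^ 2 ≤ ∫ x, ‖gradient u x‖ ^ 2 := by
  refine hardy_of_vectorField isOpen_halfSpace zero_notMem_halfSpace hu
    (fun i x => (if i = 0 then 1 else 0) * (x 0)⁻¹ + -((n : ℝ) / 2) * (x i / ‖x‖ ^ 2))
    (fun i => (contDiffOn_const.mul ((contDiff_coord 0).contDiffOn.inv fun x hx => ?_)).add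
      (contDiffOn_const.mul (contDiffOn_coord_div_norm_sq zero_notMem_halfSpace i)))
    fun x hx => ?_
  · exact (show 0 < x 0 from hx).ne'
  have h0 : x 0 ≠ 0 := (show 0 < x 0 from hx).ne'
  have hx0 : x ≠ 0 := fun h => zero_notMem_halfSpace (h ▸ hx)
  have hx' : ‖x‖ ≠ 0 := norm_ne_zero_iff.2 hx0
  choose L hL hL' using fun i => hasFDerivAt_coord_div_norm_sq hx0 i
  have hd : ∀ i, fderiv ℝ (fun x : EuclideanSpace ℝ (Fin n) =>
      (if i = 0 then 1 else 0) * (x 0)⁻¹ + -((n : ℝ) / 2) * (x i / ‖x‖ ^ 2)) x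
        (EuclideanSpace.single i 1)
      = (if i = 0 then -((x 0) ^ 2)⁻¹ else 0)
        + -((n : ℝ) / 2) * (1 / ‖x‖ ^ 2 - 2 * x i ^ 2 / ‖x‖ ^ 4) := by
    intro i
    have h1 : HasFDerivAt (fun y : EuclideanSpace ℝ (Fin n) => (y 0)⁻¹) _ x :=
      (hasDerivAt_inv h0).comp_hasFDerivAt x (hasFDerivAt_coord 0 x)
    rw [((h1.const_mul _).fun_add ((hL i).const_mul _)).fderiv]
    by_cases hi : i = 0
    · subst hi
      simp [hL']
    · simp [hL', hi]
  have hsq : ∀ i, ((if i = 0 then 1 else 0) * (x 0)⁻¹ + -((n : ℝ) / 2) * (x i / ‖x‖ ^ 2)) ^ 2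
      = (if i = 0 then ((x 0) ^ 2)⁻¹ - n / ‖x‖ ^ 2 else 0)
        + (n : ℝ) ^ 2 / 4 * (x i ^ 2 / ‖x‖ ^ 4) := by
    intro i
    by_cases hi : i = 0
    · subst hi
      simp
      field_simp
      ring
    · simp [hi]
      ring
  have hs := sum_coord_sq x
  simp only [hd, hsq, Finset.sum_add_distrib, ← Finset.mul_sum, Finset.sum_sub_distrib,
    ← Finset.sum_div, hs, Finset.sum_ite_eq', Finset.mem_univ, if_true]
  refine le_of_eq ?_
  simp
  field_simp
  ring

/-! ### Hölder, Minkowski and Sobolev inequalities -/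

theorem integral_rpow_mul_rpow_le {α : Type*} [MeasurableSpace α] {μ : Measure α} {f g : α → ℝ}
    (hf : Integrable f μ) (hg : Integrable g μ) (hf0 : ∀ x, 0 ≤ f x) (hg0 : ∀ x, 0 ≤ g x)
    {a b : ℝ} (ha : 0 ≤ a) (hb : 0 ≤ b) (hab : a + b = 1) :
    ∫ x, f x ^ a * g x ^ b ∂μ ≤ (∫ x, f x ∂μ) ^ a * (∫ x, g x ∂μ) ^ b := by
  have hF : 0 ≤ ∫ x, f x ∂μ := integral_nonneg hf0
  have hG : 0 ≤ ∫ x, g x ∂μ := integral_nonneg hg0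
  have key := ENNReal.lintegral_mul_norm_pow_le hf.aemeasurable.ennreal_ofReal
    hg.aemeasurable.ennreal_ofReal ha hb hab
  rw [← ofReal_integral_eq_lintegral_ofReal hf (ae_of_all _ hf0),
    ← ofReal_integral_eq_lintegral_ofReal hg (ae_of_all _ hg0),
    ENNReal.ofReal_rpow_of_nonneg hF ha, ENNReal.ofReal_rpow_of_nonneg hG hb,
    ← ENNReal.ofReal_mul (Real.rpow_nonneg hF a)] at key
  rw [integral_eq_lintegral_of_nonneg_ae
    (ae_of_all _ fun x => mul_nonneg (Real.rpow_nonneg (hf0 x) a) (Real.rpow_nonneg (hg0 x) b))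
    ((hf.aemeasurable.pow_const a).mul (hg.aemeasurable.pow_const b)).aestronglyMeasurable]
  refine ENNReal.toReal_le_of_le_ofReal
    (mul_nonneg (Real.rpow_nonneg hF a) (Real.rpow_nonneg hG b)) (le_trans (le_of_eq ?_) key)
  refine lintegral_congr fun x => ?_
  rw [ENNReal.ofReal_mul (Real.rpow_nonneg (hf0 x) a),
    ENNReal.ofReal_rpow_of_nonneg (hf0 x) ha, ENNReal.ofReal_rpow_of_nonneg (hg0 x) hb]

theorem integral_add_rpow_le {α : Type*} [MeasurableSpace α] {μ : Measure α} {f g : α → ℝ} {p : ℝ}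
    (hp : 1 ≤ p) (hfm : AEMeasurable f μ) (hgm : AEMeasurable g μ)
    (hf : Integrable (fun x => f x ^ p) μ) (hg : Integrable (fun x => g x ^ p) μ)
    (hf0 : ∀ x, 0 ≤ f x) (hg0 : ∀ x, 0 ≤ g x) :
    (∫ x, (f x + g x) ^ p ∂μ) ^ (1 / p) ≤
      (∫ x, f x ^ p ∂μ) ^ (1 / p) + (∫ x, g x ^ p ∂μ) ^ (1 / p) := by
  have hp0 : 0 ≤ p := zero_le_one.trans hp
  have h1p : 0 ≤ 1 / p := by positivity
  have hF : 0 ≤ ∫ x, f x ^ p ∂μ := integral_nonneg fun x => Real.rpow_nonneg (hf0 x) p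
  have hG : 0 ≤ ∫ x, g x ^ p ∂μ := integral_nonneg fun x => Real.rpow_nonneg (hg0 x) p
  have key := ENNReal.lintegral_Lp_add_le hfm.ennreal_ofReal hgm.ennreal_ofReal hp
  simp only [Pi.add_apply] at key
  simp_rw [← ENNReal.ofReal_add (hf0 _) (hg0 _),
    ENNReal.ofReal_rpow_of_nonneg (add_nonneg (hf0 _) (hg0 _)) hp0,
    ENNReal.ofReal_rpow_of_nonneg (hf0 _) hp0, ENNReal.ofReal_rpow_of_nonneg (hg0 _) hp0] at key
  rw [← ofReal_integral_eq_lintegral_ofReal hf (ae_of_all _ fun x => Real.rpow_nonneg (hf0 x) p),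
    ← ofReal_integral_eq_lintegral_ofReal hg (ae_of_all _ fun x => Real.rpow_nonneg (hg0 x) p),
    ENNReal.ofReal_rpow_of_nonneg hF h1p, ENNReal.ofReal_rpow_of_nonneg hG h1p,
    ← ENNReal.ofReal_add (Real.rpow_nonneg hF _) (Real.rpow_nonneg hG _)] at key
  rw [integral_eq_lintegral_of_nonneg_ae
    (ae_of_all _ fun x => Real.rpow_nonneg (add_nonneg (hf0 x) (hg0 x)) p)
    ((hfm.add hgm).pow_const p).aestronglyMeasurable, ENNReal.toReal_rpow]
  exact ENNReal.toReal_le_of_le_ofReal (add_nonneg (Real.rpow_nonneg hF _) (Real.rpow_nonneg hG _))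
    key

theorem two_le_critExp (hn : 3 ≤ n) {s : ℝ} (hs : s ≤ 2) : 2 ≤ critExp n s := by
  have : (3 : ℝ) ≤ n := by exact_mod_cast hn
  rw [critExp, le_div_iff₀ (by linarith)]
  linarith

theorem critExp_pos (hn : 3 ≤ n) {s : ℝ} (hs : s ≤ 2) : 0 < critExp n s :=
  two_pos.trans_le (two_le_critExp hn hs)

/-- The identity between exponents that makes `2*(s)` the interpolation exponent between the Hardy
term (weight `s/2`) and the Sobolev term (weight `1 - s/2`). -/
theorem critExp_eq_interpolation (hn : 3 ≤ n) (s : ℝ) :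
    critExp n s = s + critExp n 0 * (1 - s / 2) := by
  have : (3 : ℝ) ≤ n := by exact_mod_cast hn
  have h : (n : ℝ) - 2 ≠ 0 := by linarith
  rw [critExp, critExp]
  field_simp
  ring

theorem hardySobolevTerm_nonneg (s : ℝ) (W : Set (EuclideanSpace ℝ (Fin n)))
    (u : EuclideanSpace ℝ (Fin n) → ℝ) : 0 ≤ hardySobolevTerm s W u :=
  Real.rpow_nonneg (integral_nonneg fun x => by positivity) _

/-- Hölder's inequality for `|u|^{2*(s)} |x|^{-s} = (u² |x|^{-2})^{s/2} (|u|^{2*})^{1 - s/2}`. -/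
theorem IsTestFunction.hardySobolevTerm_le (hn : 3 ≤ n) {s : ℝ} (hs : s ∈ Set.Icc (0 : ℝ) 2)
    {W : Set (EuclideanSpace ℝ (Fin n))} (hW : (0 : EuclideanSpace ℝ (Fin n)) ∉ W)
    {u : EuclideanSpace ℝ (Fin n) → ℝ} (hu : IsTestFunction W u) :
    hardySobolevTerm s Set.univ u ≤ (∫ x, u x ^ 2 / ‖x‖ ^ 2) ^ (s / critExp n s) *
      hardySobolevTerm 0 Set.univ u ^ (1 - s / critExp n s) := by
  have hq := critExp_pos hn hs.2
  have hq0 := critExp_pos hn (s := 0) zero_le_two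
  have hcrit := critExp_eq_interpolation hn s
  simp only [hardySobolevTerm, Measure.restrict_univ]
  have hA : 0 ≤ ∫ x, u x ^ 2 / ‖x‖ ^ 2 := integral_nonneg fun x => by positivity
  have hI0 : 0 ≤ ∫ x, |u x| ^ critExp n 0 / ‖x‖ ^ (0 : ℝ) := integral_nonneg fun x => by positivity
  have key := integral_rpow_mul_rpow_le (hu.integrable_sq_div hW)
    (hu.integrable_rpow_div hW hq0 0) (fun x => by positivity) (fun x => by positivity)
    (a := s / 2) (b := 1 - s / 2) (by linarith [hs.1]) (by linarith [hs.2]) (by ring)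
  have hpt : ∀ x, |u x| ^ critExp n s / ‖x‖ ^ s =
      (u x ^ 2 / ‖x‖ ^ 2) ^ (s / 2) * (|u x| ^ critExp n 0 / ‖x‖ ^ (0 : ℝ)) ^ (1 - s / 2) := by
    intro x
    have e1 : (u x ^ 2) ^ (s / 2) = |u x| ^ s := by
      rw [← sq_abs, ← Real.rpow_natCast, ← Real.rpow_mul (abs_nonneg _)]
      congr 1; push_cast; ring
    have e2 : (‖x‖ ^ 2) ^ (s / 2) = ‖x‖ ^ s := by
      rw [← Real.rpow_natCast, ← Real.rpow_mul (norm_nonneg _)]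
      congr 1; push_cast; ring
    rw [Real.rpow_zero, div_one, Real.div_rpow (sq_nonneg _) (sq_nonneg _), e1, e2,
      ← Real.rpow_mul (abs_nonneg _), div_mul_eq_mul_div]
    congr 1
    rw [← Real.rpow_add_of_nonneg (abs_nonneg _) hs.1
      (mul_nonneg hq0.le (by linarith [hs.2])), ← hcrit]
  simp_rw [← hpt] at key
  calc (∫ x, |u x| ^ critExp n s / ‖x‖ ^ s) ^ (2 / critExp n s)
      ≤ ((∫ x, u x ^ 2 / ‖x‖ ^ 2) ^ (s / 2) *
          (∫ x, |u x| ^ critExp n 0 / ‖x‖ ^ (0 : ℝ)) ^ (1 - s / 2)) ^ (2 / critExp n s) :=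
        Real.rpow_le_rpow (integral_nonneg fun x => by positivity) key (by positivity)
    _ = _ := by
        rw [Real.mul_rpow (Real.rpow_nonneg hA _) (Real.rpow_nonneg hI0 _),
          ← Real.rpow_mul hA, ← Real.rpow_mul hI0, ← Real.rpow_mul hI0]
        congr 2
        · field_simp
        · field_simp
          linarith

/-- The Sobolev inequality in the form `(∫|u|^{2*})^{2/2*} ≤ S ∫|∇u|²`. -/
theorem exists_sobolev (hn : 3 ≤ n) : ∃ S : ℝ, 0 < S ∧
    ∀ (W : Set (EuclideanSpace ℝ (Fin n))) (u : EuclideanSpace ℝ (Fin n) → ℝ),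
      IsTestFunction W u → hardySobolevTerm 0 Set.univ u ≤ S * ∫ x, ‖gradient u x‖ ^ 2 := by
  have hn' : (3 : ℝ) ≤ n := by exact_mod_cast hn
  have hq0 := critExp_pos hn (s := 0) zero_le_two
  set q := critExp n 0 with hq
  set K := SNormLESNormFDerivOfEqConst ℝ (volume : Measure (EuclideanSpace ℝ (Fin n)))
    ((2 : NNReal) : ℝ)
  refine ⟨(K : ℝ) ^ 2 + 1, by positivity, fun W u hu => ?_⟩
  have hfr : Module.finrank ℝ (EuclideanSpace ℝ (Fin n)) = n := by simp
  have h := eLpNorm_le_eLpNorm_fderiv_of_eq (volume : Measure (EuclideanSpace ℝ (Fin n)))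
    (hu.contDiff.of_le (by simp)) hu.hasCompactSupport (p := 2) (p' := q.toNNReal)
    (by norm_num) (by rw [hfr]; omega) (by
      rw [hfr, Real.coe_toNNReal _ hq0.le, hq, critExp]
      have : (n : ℝ) - 2 ≠ 0 := by linarith
      have : (n : ℝ) ≠ 0 := by linarith
      push_cast
      field_simp
      ring)
  have hD : 0 ≤ ∫ x, ‖gradient u x‖ ^ 2 := integral_nonneg fun x => by positivity
  have hI : 0 ≤ ∫ x, |u x| ^ q := integral_nonneg fun x => by positivity
  have m1 : MemLp u (q.toNNReal : ENNReal) :=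
    hu.contDiff.continuous.memLp_of_hasCompactSupport hu.hasCompactSupport
  have m2 : MemLp (fderiv ℝ u) (2 : NNReal) :=
    (hu.contDiff.continuous_fderiv (by simp)).memLp_of_hasCompactSupport
      (hu.hasCompactSupport.fderiv ℝ)
  have hng : ∀ x, ‖fderiv ℝ u x‖ = ‖gradient u x‖ := fun x => by simp [gradient]
  rw [m1.eLpNorm_eq_integral_rpow_norm (by simpa using hq0) (by simp),
    m2.eLpNorm_eq_integral_rpow_norm (by simp) (by simp), ← ENNReal.ofReal_coe_nnreal (p := K),
    ← ENNReal.ofReal_mul (by positivity)] at h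
  simp only [ENNReal.coe_toReal, NNReal.coe_ofNat, Real.coe_toNNReal _ hq0.le,
    Real.rpow_two, hng, Real.norm_eq_abs] at h
  rw [ENNReal.ofReal_le_ofReal_iff (by positivity)] at h
  simp only [hardySobolevTerm, Measure.restrict_univ, Real.rpow_zero, div_one]
  calc (∫ x, |u x| ^ q) ^ (2 / q) = ((∫ x, |u x| ^ q) ^ q⁻¹) ^ 2 := by
        rw [← Real.rpow_natCast, ← Real.rpow_mul hI]
        congr 1; push_cast; ring
    _ ≤ (K * (∫ x, ‖gradient u x‖ ^ 2) ^ (2 : ℝ)⁻¹) ^ 2 :=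
        pow_le_pow_left₀ (Real.rpow_nonneg hI _) h 2
    _ = (K : ℝ) ^ 2 * ∫ x, ‖gradient u x‖ ^ 2 := by
        rw [mul_pow, ← Real.rpow_natCast (_ ^ _), ← Real.rpow_mul hD]
        norm_num
    _ ≤ _ := by nlinarith

/-- The Hardy inequality with the constant `4`, which is valid in all dimensions `n ≥ 3`. -/
theorem IsTestFunction.integral_sq_div_le (hn : 3 ≤ n) {W : Set (EuclideanSpace ℝ (Fin n))}
    (hWo : IsOpen W) (hW : (0 : EuclideanSpace ℝ (Fin n)) ∉ W)
    {u : EuclideanSpace ℝ (Fin n) → ℝ} (hu : IsTestFunction W u) :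
    ∫ x, u x ^ 2 / ‖x‖ ^ 2 ≤ 4 * ∫ x, ‖gradient u x‖ ^ 2 := by
  have hn' : (3 : ℝ) ≤ n := by exact_mod_cast hn
  have hA : 0 ≤ ∫ x, u x ^ 2 / ‖x‖ ^ 2 := integral_nonneg fun x => by positivity
  have := hardy_punctured hWo hW hu
  nlinarith [mul_nonneg hA (by nlinarith : (0 : ℝ) ≤ ((n : ℝ) - 2) ^ 2 - 1)]

/-- The Hardy-Sobolev inequality, interpolated between the Hardy and the Sobolev inequality. -/
theorem exists_hardySobolev (hn : 3 ≤ n) {s : ℝ} (hs : s ∈ Set.Icc (0 : ℝ) 2) : ∃ C : ℝ, 0 < C ∧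
    ∀ (W : Set (EuclideanSpace ℝ (Fin n))) (u : EuclideanSpace ℝ (Fin n) → ℝ),
      IsOpen W → (0 : EuclideanSpace ℝ (Fin n)) ∉ W →
      IsTestFunction W u → hardySobolevTerm s Set.univ u ≤ C * ∫ x, ‖gradient u x‖ ^ 2 := by
  obtain ⟨S, hS, hSob⟩ := exists_sobolev hn
  refine ⟨max 4 S, by positivity, fun W u hWo hW hu => ?_⟩
  have hq := critExp_pos hn hs.2
  have hD : 0 ≤ ∫ x, ‖gradient u x‖ ^ 2 := integral_nonneg fun x => by positivity
  have hA : 0 ≤ ∫ x, u x ^ 2 / ‖x‖ ^ 2 := integral_nonneg fun x => by positivity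
  set M := max 4 S * ∫ x, ‖gradient u x‖ ^ 2 with hM
  have hM0 : 0 ≤ M := by positivity
  have h1 : s / critExp n s ≤ 1 := by
    rw [div_le_one hq]
    exact hs.2.trans (two_le_critExp hn hs.2)
  calc hardySobolevTerm s Set.univ u
      ≤ (∫ x, u x ^ 2 / ‖x‖ ^ 2) ^ (s / critExp n s) *
          hardySobolevTerm 0 Set.univ u ^ (1 - s / critExp n s) := hu.hardySobolevTerm_le hn hs hW
    _ ≤ M ^ (s / critExp n s) * M ^ (1 - s / critExp n s) := by
        refine mul_le_mul
          (Real.rpow_le_rpow hA ((hu.integral_sq_div_le hn hWo hW).trans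
            (mul_le_mul_of_nonneg_right (le_max_left _ _) hD)) (div_nonneg hs.1 hq.le))
          (Real.rpow_le_rpow (hardySobolevTerm_nonneg _ _ _) ((hSob W u hu).trans
            (mul_le_mul_of_nonneg_right (le_max_right _ _) hD)) (by linarith))
          (Real.rpow_nonneg (hardySobolevTerm_nonneg _ _ _) _) (Real.rpow_nonneg hM0 _)
    _ = M := by
        rw [← Real.rpow_add_of_nonneg hM0 (div_nonneg hs.1 hq.le) (by linarith)]
        simp

/-- Since `2*(s)/2 ≥ 1`, Minkowski's inequality for `u² = (η₁u)² + (η₂u)²` in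
`L^{2*(s)/2}(|x|^{-s} dx)` splits the Hardy-Sobolev term along a quadratic partition of unity. -/
theorem IsTestFunction.hardySobolevTerm_le_add (hn : 3 ≤ n) {s : ℝ} (hs : s ∈ Set.Icc (0 : ℝ) 2)
    {W : Set (EuclideanSpace ℝ (Fin n))} (hW : (0 : EuclideanSpace ℝ (Fin n)) ∉ W)
    {u : EuclideanSpace ℝ (Fin n) → ℝ} (hu : IsTestFunction W u)
    {η₁ η₂ : EuclideanSpace ℝ (Fin n) → ℝ} (h₁ : ContDiff ℝ ∞ η₁) (h₂ : ContDiff ℝ ∞ η₂)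
    (h : ∀ x, η₁ x ^ 2 + η₂ x ^ 2 = 1) :
    hardySobolevTerm s Set.univ u ≤ hardySobolevTerm s Set.univ (fun x => η₁ x * u x) +
      hardySobolevTerm s Set.univ (fun x => η₂ x * u x) := by
  have hq := critExp_pos hn hs.2
  have hq2 := two_le_critExp hn hs.2
  set q := critExp n s with hqdef
  have hpw : ∀ (a : ℝ) (x : EuclideanSpace ℝ (Fin n)),
      (a ^ 2 / (‖x‖ ^ s) ^ (2 / q)) ^ (q / 2) = |a| ^ q / ‖x‖ ^ s := by
    intro a x
    rw [Real.div_rpow (sq_nonneg _) (by positivity), ← Real.rpow_mul (by positivity),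
      ← sq_abs, ← Real.rpow_natCast, ← Real.rpow_mul (abs_nonneg _)]
    have e1 : 2 / q * (q / 2) = 1 := by field_simp
    have e2 : ((2 : ℕ) : ℝ) * (q / 2) = q := by push_cast; ring
    rw [e1, e2, Real.rpow_one]
  have hm : ∀ {v : EuclideanSpace ℝ (Fin n) → ℝ}, Continuous v →
      AEMeasurable (fun x : EuclideanSpace ℝ (Fin n) => v x ^ 2 / (‖x‖ ^ s) ^ (2 / q)) := by
    intro v hv
    have := hv.measurable
    exact Measurable.aemeasurable (by fun_prop)
  have key := integral_add_rpow_le (p := q / 2) (by linarith)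
    (hm (hu.mul_left h₁).contDiff.continuous) (hm (hu.mul_left h₂).contDiff.continuous)
    (by simpa only [hpw] using (hu.mul_left h₁).integrable_rpow_div hW hq s)
    (by simpa only [hpw] using (hu.mul_left h₂).integrable_rpow_div hW hq s)
    (fun x => by positivity) (fun x => by positivity)
  have hadd : ∀ x, (η₁ x * u x) ^ 2 / (‖x‖ ^ s) ^ (2 / q) + (η₂ x * u x) ^ 2 / (‖x‖ ^ s) ^ (2 / q)
      = u x ^ 2 / (‖x‖ ^ s) ^ (2 / q) := by
    intro x
    rw [← add_div, mul_pow, mul_pow, ← add_mul, h, one_mul]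
  simp only [hadd, hpw, one_div_div] at key
  simpa only [hardySobolevTerm, Measure.restrict_univ] using key

/-! ### Approximation by test functions -/

theorem tendsto_integral_norm_rpow_of_tendsto_eLpNorm {α F : Type*} [MeasurableSpace α]
    [NormedAddCommGroup F] {μ : Measure α} {q : ℝ} (hq : 1 ≤ q) {f : ℕ → α → F} {g : α → F}
    (hf : ∀ k, MemLp (f k) (ENNReal.ofReal q) μ) (hg : AEStronglyMeasurable g μ)
    (h : Tendsto (fun k => eLpNorm (f k - g) (ENNReal.ofReal q) μ) atTop (𝓝 0)) :
    Integrable (fun x => ‖g x‖ ^ q) μ ∧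
      Tendsto (fun k => ∫ x, ‖f k x‖ ^ q ∂μ) atTop (𝓝 (∫ x, ‖g x‖ ^ q ∂μ)) := by
  have hq0 : 0 < q := zero_lt_one.trans_le hq
  have hp : (1 : ENNReal) ≤ ENNReal.ofReal q := by simpa using hq
  have hp0 : ENNReal.ofReal q ≠ 0 := by simpa using hq0
  have hpT : (ENNReal.ofReal q).toReal = q := ENNReal.toReal_ofReal hq0.le
  have : Fact ((1 : ENNReal) ≤ ENNReal.ofReal q) := ⟨hp⟩
  have hgL : MemLp g (ENNReal.ofReal q) μ := by
    obtain ⟨k, hk⟩ := (h.eventually (gt_mem_nhds zero_lt_one)).exists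
    have h1 : MemLp (f k - g) (ENNReal.ofReal q) μ :=
      ⟨(hf k).1.sub hg, hk.trans ENNReal.one_lt_top⟩
    simpa using (hf k).sub h1
  have hint : ∀ v : α → F, MemLp v (ENNReal.ofReal q) μ →
      ∫ x, ‖v x‖ ^ q ∂μ = (eLpNorm v (ENNReal.ofReal q) μ).toReal ^ q := by
    intro v hv
    have h0 : 0 ≤ ∫ x, ‖v x‖ ^ q ∂μ := integral_nonneg fun x => by positivity
    rw [hv.eLpNorm_eq_integral_rpow_norm hp0 ENNReal.ofReal_ne_top, hpT,
      ENNReal.toReal_ofReal (by positivity), ← Real.rpow_mul h0, inv_mul_cancel₀ hq0.ne',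
      Real.rpow_one]
  refine ⟨by simpa only [hpT] using hgL.integrable_norm_rpow hp0 ENNReal.ofReal_ne_top, ?_⟩
  have h2 := ((Lp.tendsto_Lp_iff_tendsto_eLpNorm'' f hf g hgL).2 h).norm
  simp only [Lp.norm_toLp] at h2
  simp only [hint g hgL, fun k => hint (f k) (hf k)]
  exact h2.rpow_const (Or.inr hq0.le)

/-- Fatou's lemma applied to the differences `φ k - φ m`: if the approximating functions converge
in `L²` after applying `D`, and `D` controls a weighted `Lᵖ` norm of their differences, then they
converge in that weighted norm as well. -/
theorem tendsto_eLpNorm_weight_mul_sub {α F : Type*} [MeasurableSpace α]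
    [NormedAddCommGroup F] {μ : Measure α} {p : ENNReal} {w : α → ℝ}
    (hw : AEStronglyMeasurable w μ) {φ : ℕ → α → ℝ} (hφ : ∀ k, AEStronglyMeasurable (φ k) μ)
    {u : α → ℝ} {D : ℕ → α → F} (hD : ∀ k, AEStronglyMeasurable (D k) μ) {G : α → F}
    (hG : AEStronglyMeasurable G μ) {ns : ℕ → ℕ} (hns : StrictMono ns)
    (hae : ∀ᵐ x ∂μ, Tendsto (fun j => φ (ns j) x) atTop (𝓝 (u x)))
    {C : ENNReal} (hC : C ≠ ⊤)
    (hest : ∀ k m, eLpNorm (fun x => w x * (φ k x - φ m x)) p μ ≤ C * eLpNorm (D k - D m) 2 μ)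
    (hlim : Tendsto (fun k => eLpNorm (D k - G) 2 μ) atTop (𝓝 0)) :
    Tendsto (fun k => eLpNorm (fun x => w x * (φ k x - u x)) p μ) atTop (𝓝 0) := by
  have hbound : ∀ k, eLpNorm (fun x => w x * (φ k x - u x)) p μ ≤ C * eLpNorm (D k - G) 2 μ := by
    intro k
    have h1 := Lp.eLpNorm_lim_le_liminf_eLpNorm (p := p) (μ := μ)
      (f := fun j x => w x * (φ k x - φ (ns j) x)) (fun j => hw.mul ((hφ k).sub (hφ (ns j))))
      (fun x => w x * (φ k x - u x)) (by
        filter_upwards [hae] with x hx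
        exact (tendsto_const_nhds.sub hx).const_mul _)
    have h2 : ∀ j, eLpNorm (fun x => w x * (φ k x - φ (ns j) x)) p μ ≤
        C * (eLpNorm (D k - G) 2 μ + eLpNorm (D (ns j) - G) 2 μ) := by
      intro j
      refine (hest k (ns j)).trans (mul_le_mul_right ?_ C)
      have : D k - D (ns j) = (D k - G) - (D (ns j) - G) := by abel
      rw [this]
      exact eLpNorm_sub_le ((hD k).sub hG) ((hD _).sub hG) (by norm_num)
    have h3 : Tendsto (fun j => C * (eLpNorm (D k - G) 2 μ + eLpNorm (D (ns j) - G) 2 μ)) atTop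
        (𝓝 (C * (eLpNorm (D k - G) 2 μ + 0))) :=
      ENNReal.Tendsto.const_mul
        (tendsto_const_nhds.add (hlim.comp hns.tendsto_atTop)) (Or.inr hC)
    rw [add_zero] at h3
    rw [← h3.liminf_eq]
    exact h1.trans (liminf_le_liminf (Eventually.of_forall h2))
  refine tendsto_of_tendsto_of_tendsto_of_le_of_le tendsto_const_nhds ?_ (fun _ => zero_le) hbound
  simpa using ENNReal.Tendsto.const_mul hlim (Or.inr hC)

/-- Weak gradients are unique almost everywhere. -/
theorem HasWeakGradientOn.ae_eq {W : Set (EuclideanSpace ℝ (Fin n))} (hWo : IsOpen W)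
    {u : EuclideanSpace ℝ (Fin n) → ℝ} {G G' : EuclideanSpace ℝ (Fin n) → EuclideanSpace ℝ (Fin n)}
    (h : HasWeakGradientOn W u G) (h' : HasWeakGradientOn W u G') :
    G =ᵐ[volume.restrict W] G' := by
  have key := hWo.ae_eq_zero_of_integral_contDiff_smul_eq_zero (μ := volume)
    (f := fun x => G x - G' x)
    (h.locallyIntegrableOn_grad.sub h'.locallyIntegrableOn_grad) fun g hg hgc hgW => by
      have hgt : IsTestFunction W g := ⟨hg, hgc, hgW⟩
      have hint : ∀ H : EuclideanSpace ℝ (Fin n) → EuclideanSpace ℝ (Fin n),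
          LocallyIntegrableOn H W → Integrable fun x => g x • H x := by
        intro H hH
        have h1 := (hH.integrableOn_compact_subset hgW hgc).continuousOn_smul
          hg.continuous.continuousOn hgc
        rwa [integrableOn_iff_integrable_of_support_subset] at h1
        intro x hx
        by_contra hxK
        exact hx (by simp [image_eq_zero_of_notMem_tsupport hxK])
      have hset : ∀ H : EuclideanSpace ℝ (Fin n) → EuclideanSpace ℝ (Fin n),
          ∫ x in W, g x • H x = ∫ x, g x • H x := fun H =>
        setIntegral_eq_integral_of_forall_compl_eq_zero fun x hx => by
          simp [hgt.eq_zero_of_notMem hx]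
      have e1 := h.integral_eq g hgt
      rw [h'.integral_eq g hgt, neg_inj, hset, hset] at e1
      simp only [smul_sub]
      rw [integral_sub (hint G h.locallyIntegrableOn_grad) (hint G' h'.locallyIntegrableOn_grad),
        e1, sub_self]
  rw [EventuallyEq, ae_restrict_iff' hWo.measurableSet]
  filter_upwards [key] with x hx hxW
  exact sub_eq_zero.1 (hx hxW)

theorem IsTestFunction.eLpNorm_weight_mul_le {W : Set (EuclideanSpace ℝ (Fin n))}
    {w : EuclideanSpace ℝ (Fin n) → ℝ} (hw : Measurable w) {q C : ℝ} (hq : 0 < q)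
    {φ : EuclideanSpace ℝ (Fin n) → ℝ} (hφ : IsTestFunction W φ)
    (hint : Integrable fun x => |w x * φ x| ^ q)
    (hC : (∫ x, |w x * φ x| ^ q) ^ (2 / q) ≤ C * ∫ x, ‖gradient φ x‖ ^ 2) :
    MemLp (fun x => w x * φ x) (ENNReal.ofReal q) ∧
      eLpNorm (fun x => w x * φ x) (ENNReal.ofReal q) volume ≤
      ENNReal.ofReal (√C) * eLpNorm (gradient φ) 2 volume := by
  have hp0 : ENNReal.ofReal q ≠ 0 := by simpa using hq
  have hpT : (ENNReal.ofReal q).toReal = q := ENNReal.toReal_ofReal hq.le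
  have hm : MemLp (fun x => w x * φ x) (ENNReal.ofReal q) := by
    have hmeas : Measurable fun x => w x * φ x := hw.mul hφ.contDiff.continuous.measurable
    rw [← integrable_norm_rpow_iff hmeas.aestronglyMeasurable hp0 ENNReal.ofReal_ne_top, hpT]
    exact hint
  have hm2 : MemLp (gradient φ) 2 := by
    rw [← integrable_norm_rpow_iff hφ.continuous_gradient.aestronglyMeasurable
      two_ne_zero ENNReal.ofNat_ne_top]
    simpa using hφ.integrable_norm_gradient_sq
  refine ⟨hm, ?_⟩
  have hI : 0 ≤ ∫ x, |w x * φ x| ^ q := integral_nonneg fun x => by positivity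
  have hD : 0 ≤ ∫ x, ‖gradient φ x‖ ^ 2 := integral_nonneg fun x => by positivity
  rw [hm.eLpNorm_eq_integral_rpow_norm hp0 ENNReal.ofReal_ne_top, hpT,
    hm2.eLpNorm_eq_integral_rpow_norm two_ne_zero ENNReal.ofNat_ne_top,
    ← ENNReal.ofReal_mul (Real.sqrt_nonneg _)]
  refine ENNReal.ofReal_le_ofReal ?_
  simp only [Real.norm_eq_abs, ENNReal.toReal_ofNat, Real.rpow_two]
  rw [← one_div (2 : ℝ), ← Real.sqrt_eq_rpow, ← Real.sqrt_mul' _ hD]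
  refine Real.le_sqrt_of_sq_le (le_trans (le_of_eq ?_) hC)
  rw [← Real.rpow_natCast, ← Real.rpow_mul hI]
  congr 1
  push_cast
  ring

/-- Weighted norms that are controlled by the gradient pass to the limit along an approximating
sequence of test functions. -/
theorem tendsto_integral_abs_weight_mul_rpow {W : Set (EuclideanSpace ℝ (Fin n))}
    {w : EuclideanSpace ℝ (Fin n) → ℝ} (hw : Measurable w) {q C : ℝ} (hq : 1 ≤ q)
    (hest : ∀ φ, IsTestFunction W φ → Integrable (fun x => |w x * φ x| ^ q) ∧
      (∫ x, |w x * φ x| ^ q) ^ (2 / q) ≤ C * ∫ x, ‖gradient φ x‖ ^ 2)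
    {φ : ℕ → EuclideanSpace ℝ (Fin n) → ℝ} (hφ : ∀ k, IsTestFunction W (φ k))
    {u : EuclideanSpace ℝ (Fin n) → ℝ} (hu : AEStronglyMeasurable u (volume.restrict W))
    {G : EuclideanSpace ℝ (Fin n) → EuclideanSpace ℝ (Fin n)}
    (hG : AEStronglyMeasurable G (volume.restrict W)) {ns : ℕ → ℕ} (hns : StrictMono ns)
    (hae : ∀ᵐ x ∂(volume.restrict W), Tendsto (fun j => φ (ns j) x) atTop (𝓝 (u x)))
    (hlim : Tendsto (fun k => eLpNorm (fun x => gradient (φ k) x - G x) 2 (volume.restrict W))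
      atTop (𝓝 0)) :
    IntegrableOn (fun x => |w x * u x| ^ q) W ∧
      Tendsto (fun k => ∫ x, |w x * φ k x| ^ q) atTop (𝓝 (∫ x in W, |w x * u x| ^ q)) := by
  have hq0 : 0 < q := zero_lt_one.trans_le hq
  have hgsub : ∀ k m, gradient (fun x => φ k x - φ m x) = gradient (φ k) - gradient (φ m) := by
    intro k m
    ext1 x
    simp [gradient, fderiv_fun_sub ((hφ k).differentiable x) ((hφ m).differentiable x)]
  have h1 := tendsto_eLpNorm_weight_mul_sub (p := ENNReal.ofReal q) hw.aestronglyMeasurable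
    (fun k => (hφ k).contDiff.continuous.aestronglyMeasurable) (D := fun k => gradient (φ k))
    (fun k => (hφ k).continuous_gradient.aestronglyMeasurable) hG hns hae
    (ENNReal.ofReal_ne_top (r := √C)) (fun k m => by
      have ht := (hφ k).sub (hφ m)
      have := (ht.eLpNorm_weight_mul_le hw hq0 (hest _ ht).1 (hest _ ht).2).2
      rw [hgsub] at this
      refine (eLpNorm_mono_measure _ Measure.restrict_le_self).trans (this.trans (le_of_eq ?_))
      rw [eLpNorm_restrict_eq_of_support_subset]
      intro x hx
      by_contra hxW
      refine hx ?_
      rw [← hgsub]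
      exact IsTestFunction.gradient_eq_zero fun h => hxW (ht.tsupport_subset h)) hlim
  have h2 := tendsto_integral_norm_rpow_of_tendsto_eLpNorm (μ := volume.restrict W) hq
    (f := fun k x => w x * φ k x) (g := fun x => w x * u x)
    (fun k =>
      ((hφ k).eLpNorm_weight_mul_le hw hq0 (hest _ (hφ k)).1 (hest _ (hφ k)).2).1.restrict W)
    (hw.aestronglyMeasurable.mul hu) (by
      refine h1.congr fun k => ?_
      congr 1
      ext x
      simp [mul_sub])
  refine ⟨h2.1, h2.2.congr fun k => ?_⟩
  exact setIntegral_eq_integral_of_forall_compl_eq_zero fun x hx => by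
    simp [(hφ k).eq_zero_of_notMem hx, Real.zero_rpow hq0.ne']

/-- The weight `|x|^{-s}` of the Hardy-Sobolev term, moved inside the power `q`. -/
theorem abs_weight_mul_rpow {q : ℝ} (hq : 0 < q) (s : ℝ)
    (a : ℝ) (x : EuclideanSpace ℝ (Fin n)) :
    |((‖x‖ ^ s) ^ q⁻¹)⁻¹ * a| ^ q = |a| ^ q / ‖x‖ ^ s := by
  have h0 : 0 ≤ ‖x‖ ^ s := by positivity
  rw [abs_mul, abs_of_nonneg (by positivity), Real.mul_rpow (by positivity) (abs_nonneg _),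
    Real.inv_rpow (by positivity), ← Real.rpow_mul h0, inv_mul_cancel₀ hq.ne', Real.rpow_one,
    inv_mul_eq_div]

theorem critExp_two (hn : 3 ≤ n) : critExp n 2 = 2 := by
  have : (3 : ℝ) ≤ n := by exact_mod_cast hn
  have h : (n : ℝ) - 2 ≠ 0 := by linarith
  rw [critExp]
  field_simp

/-- Elements of `D^{1,2}(W)` are approximated by test functions in all the quantities that occur
in the Hardy-Sobolev inequalities. -/
theorem MemD12.exists_approximation (hn : 3 ≤ n) {W : Set (EuclideanSpace ℝ (Fin n))}
    (hWo : IsOpen W) (hW : (0 : EuclideanSpace ℝ (Fin n)) ∉ W)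
    {u : EuclideanSpace ℝ (Fin n) → ℝ} {G : EuclideanSpace ℝ (Fin n) → EuclideanSpace ℝ (Fin n)}
    (hu : MemD12 W u) (hG : HasWeakGradientOn W u G) :
    ∃ φ : ℕ → EuclideanSpace ℝ (Fin n) → ℝ, (∀ k, IsTestFunction W (φ k)) ∧
      (∀ s ∈ Set.Icc (0 : ℝ) 2, IntegrableOn (fun x => |u x| ^ critExp n s / ‖x‖ ^ s) W ∧
        Tendsto (fun k => ∫ x, |φ k x| ^ critExp n s / ‖x‖ ^ s) atTop
          (𝓝 (∫ x in W, |u x| ^ critExp n s / ‖x‖ ^ s))) ∧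
      (IntegrableOn (fun x => u x ^ 2 / ‖x‖ ^ 2) W ∧
        Tendsto (fun k => ∫ x, φ k x ^ 2 / ‖x‖ ^ 2) atTop (𝓝 (∫ x in W, u x ^ 2 / ‖x‖ ^ 2))) ∧
      (IntegrableOn (fun x => ‖G x‖ ^ 2) W ∧
        Tendsto (fun k => ∫ x, ‖gradient (φ k) x‖ ^ 2) atTop (𝓝 (∫ x in W, ‖G x‖ ^ 2))) ∧
      (Bornology.IsBounded W → IntegrableOn (fun x => u x ^ 2) W ∧
        Tendsto (fun k => ∫ x, φ k x ^ 2) atTop (𝓝 (∫ x in W, u x ^ 2))) := by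
  obtain ⟨hup, G', hG', hG'2, φ, hφ, hlimG', hlimu⟩ := hu
  have hGG' := hG.ae_eq hWo hG'
  have hGm : AEStronglyMeasurable G (volume.restrict W) := hG'2.1.congr hGG'.symm
  have hlimG : Tendsto (fun k => eLpNorm (fun x => gradient (φ k) x - G x) 2 (volume.restrict W))
      atTop (𝓝 0) := by
    refine hlimG'.congr fun k => eLpNorm_congr_ae ?_
    filter_upwards [hGG'] with x hx
    rw [hx]
  obtain ⟨ns, hns, hae⟩ := (tendstoInMeasure_of_tendsto_eLpNorm
    (by simpa using critExp_pos hn (s := 0) zero_le_two)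
    (fun k => (hφ k).contDiff.continuous.aestronglyMeasurable) hup.1 hlimu).exists_seq_tendsto_ae
  -- the case `s = 2` of this step is the Hardy term, since `2*(2) = 2`
  have hT : ∀ s ∈ Set.Icc (0 : ℝ) 2, IntegrableOn (fun x => |u x| ^ critExp n s / ‖x‖ ^ s) W ∧
        Tendsto (fun k => ∫ x, |φ k x| ^ critExp n s / ‖x‖ ^ s) atTop
          (𝓝 (∫ x in W, |u x| ^ critExp n s / ‖x‖ ^ s)) := by
    intro s hs
    obtain ⟨C, hC, hCest⟩ := exists_hardySobolev hn hs
    have hq := critExp_pos hn hs.2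
    have h := tendsto_integral_abs_weight_mul_rpow (W := W) (C := C)
      (w := fun x => ((‖x‖ ^ s) ^ (critExp n s)⁻¹)⁻¹) (by fun_prop)
      (one_le_two.trans (two_le_critExp hn hs.2)) (fun ψ hψ => by
        simp only [abs_weight_mul_rpow hq]
        refine ⟨hψ.integrable_rpow_div hW hq s, ?_⟩
        simpa only [hardySobolevTerm, Measure.restrict_univ] using hCest W ψ hWo hW hψ)
      hφ hup.1 hGm hns hae hlimG
    simpa only [abs_weight_mul_rpow hq] using h
  refine ⟨φ, hφ, hT, ?_, ?_, fun hbdd => ?_⟩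
  · simpa only [critExp_two hn, Real.rpow_two, sq_abs] using hT 2 ⟨zero_le_two, le_rfl⟩
  · have hm2 : ∀ k, MemLp (gradient (φ k)) (ENNReal.ofReal 2) (volume.restrict W) := fun k => by
      have : MemLp (gradient (φ k)) (ENNReal.ofReal 2) := by
        rw [← integrable_norm_rpow_iff (hφ k).continuous_gradient.aestronglyMeasurable
          (by simp) (by simp)]
        simpa using (hφ k).integrable_norm_gradient_sq
      exact this.restrict W
    have h := tendsto_integral_norm_rpow_of_tendsto_eLpNorm (μ := volume.restrict W)
      (one_le_two (α := ℝ)) hm2 hGm (by rw [ENNReal.ofReal_ofNat]; exact hlimG)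
    simp only [Real.rpow_two] at h
    refine ⟨h.1, h.2.congr fun k => ?_⟩
    exact setIntegral_eq_integral_of_forall_compl_eq_zero fun x hx => by
      simp [IsTestFunction.gradient_eq_zero fun h => hx ((hφ k).tsupport_subset h)]
  -- on a bounded set `u² ≤ R² u²/|x|²`, so the Hardy inequality controls the `L²` norm
  · obtain ⟨R, hR⟩ := hbdd.subset_closedBall (0 : EuclideanSpace ℝ (Fin n))
    have h := tendsto_integral_abs_weight_mul_rpow (W := W) (q := 2) (C := R ^ 2 * 4)
      (w := fun _ => 1) measurable_const one_le_two (fun ψ hψ => by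
        simp only [one_mul, Real.rpow_two, sq_abs]
        refine ⟨hψ.integrable_sq, ?_⟩
        rw [div_self two_ne_zero, Real.rpow_one]
        calc ∫ x, ψ x ^ 2 ≤ ∫ x, R ^ 2 * (ψ x ^ 2 / ‖x‖ ^ 2) := by
              refine integral_mono hψ.integrable_sq ((hψ.integrable_sq_div hW).const_mul _)
                fun x => ?_
              by_cases hx : x ∈ W
              · have hx0 : 0 < ‖x‖ := norm_pos_iff.2 fun h => hW (h ▸ hx)
                have hxR : ‖x‖ ≤ R := by simpa using hR hx
                simp only
                rw [mul_div_assoc', le_div_iff₀ (by positivity), mul_comm]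
                gcongr
              · simp [hψ.eq_zero_of_notMem hx]
          _ = R ^ 2 * ∫ x, ψ x ^ 2 / ‖x‖ ^ 2 := integral_const_mul _ _
          _ ≤ R ^ 2 * (4 * ∫ x, ‖gradient ψ x‖ ^ 2) :=
              mul_le_mul_of_nonneg_left (hψ.integral_sq_div_le hn hWo hW) (sq_nonneg R)
          _ = _ := by ring)
      hφ hup.1 hGm hns hae hlimG
    simpa only [one_mul, Real.rpow_two, sq_abs] using h

/-! ### The best constant of the half-space -/

theorem IsTestFunction.hasWeakGradientOn {W : Set (EuclideanSpace ℝ (Fin n))}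
    {u : EuclideanSpace ℝ (Fin n) → ℝ} (hu : IsTestFunction W u) :
    HasWeakGradientOn W u (gradient u) := by
  refine ⟨hu.contDiff.continuous.locallyIntegrable.locallyIntegrableOn W,
    hu.continuous_gradient.locallyIntegrable.locallyIntegrableOn W, fun φ hφ => ?_⟩
  have hcoord : ∀ (v : EuclideanSpace ℝ (Fin n) → ℝ) x i,
      gradient v x i = fderiv ℝ v x (EuclideanSpace.single i 1) := by
    intro v x i
    rw [← inner_gradient_left, EuclideanSpace.inner_single_right]
    simp
  have hi1 : Integrable fun x => u x • gradient φ x :=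
    hu.integrable_of_continuousOn
      (hu.contDiff.continuous.smul hφ.continuous_gradient).continuousOn
      fun x hx => by simp [image_eq_zero_of_notMem_tsupport hx]
  have hi2 : Integrable fun x => φ x • gradient u x :=
    hu.integrable_of_continuousOn
      (hφ.contDiff.continuous.smul hu.continuous_gradient).continuousOn
      fun x hx => by simp [gradient_eq_zero hx]
  have hcomp : ∀ {f : EuclideanSpace ℝ (Fin n) → EuclideanSpace ℝ (Fin n)}, Integrable f →
      ∀ i, (∫ x, f x) i = ∫ x, f x i := fun hf i =>
    ((EuclideanSpace.proj i : EuclideanSpace ℝ (Fin n) →L[ℝ] ℝ).integral_comp_comm hf).symm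
  rw [setIntegral_eq_integral_of_forall_compl_eq_zero fun x hx => by
      simp [hu.eq_zero_of_notMem hx],
    setIntegral_eq_integral_of_forall_compl_eq_zero fun x hx => by
      simp [hφ.eq_zero_of_notMem hx]]
  ext i
  have hi1' : Integrable fun x => (u x • gradient φ x) i :=
    (EuclideanSpace.proj i : EuclideanSpace ℝ (Fin n) →L[ℝ] ℝ).integrable_comp hi1
  have hi2' : Integrable fun x => (φ x • gradient u x) i :=
    (EuclideanSpace.proj i : EuclideanSpace ℝ (Fin n) →L[ℝ] ℝ).integrable_comp hi2
  rw [PiLp.neg_apply, hcomp hi1, hcomp hi2]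
  simp only [PiLp.smul_apply, hcoord, smul_eq_mul] at hi1' hi2' ⊢
  have hi3 : Integrable fun x => u x * φ x :=
    hu.integrable_of_continuousOn (hu.contDiff.continuous.mul hφ.contDiff.continuous).continuousOn
      fun x hx => by simp [image_eq_zero_of_notMem_tsupport hx]
  rw [integral_mul_fderiv_eq_neg_fderiv_mul_of_integrable (by simpa only [mul_comm] using hi2')
    hi1' hi3 (fun x _ => hu.differentiable x) fun x _ => hφ.differentiable x]
  simp only [mul_comm]

theorem IsTestFunction.memD12 {W : Set (EuclideanSpace ℝ (Fin n))}
    {u : EuclideanSpace ℝ (Fin n) → ℝ} (hu : IsTestFunction W u) : MemD12 W u := by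
  refine ⟨(hu.contDiff.continuous.memLp_of_hasCompactSupport hu.hasCompactSupport).restrict W,
    gradient u, hu.hasWeakGradientOn, ?_, fun _ => u, fun _ => hu, by simp, by simp⟩
  exact (hu.continuous_gradient.memLp_of_hasCompactSupport
    (hu.hasCompactSupport.mono' fun x hx => by
      by_contra h
      exact hx (gradient_eq_zero h))).restrict W

/-- The subcritical form `∫|∇u|² - γ ∫u²/|x|²` is coercive on the half-space. -/
theorem halfSpace_hardy_coercive [NeZero n] {γ : ℝ} (hγ : γ < (n : ℝ) ^ 2 / 4) :
    ∃ κ : ℝ, 0 < κ ∧ ∀ u : EuclideanSpace ℝ (Fin n) → ℝ, IsTestFunction (halfSpace n) u →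
      κ * ∫ x, ‖gradient u x‖ ^ 2 ≤
        (∫ x, ‖gradient u x‖ ^ 2) - γ * ∫ x, u x ^ 2 / ‖x‖ ^ 2 := by
  have hn : (0 : ℝ) < n := by exact_mod_cast Nat.pos_of_ne_zero (NeZero.ne n)
  set h := (n : ℝ) ^ 2 / 4 with hh
  have hh0 : 0 < h := by positivity
  refine ⟨1 - max γ 0 / h, ?_, fun u hu => ?_⟩
  · rw [sub_pos, div_lt_one hh0]
    exact max_lt hγ hh0
  · have hA : 0 ≤ ∫ x, u x ^ 2 / ‖x‖ ^ 2 := integral_nonneg fun x => by positivity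
    have h1 := hardy_halfSpace hu
    have h2 : max γ 0 * ∫ x, u x ^ 2 / ‖x‖ ^ 2 ≤ max γ 0 / h * ∫ x, ‖gradient u x‖ ^ 2 := by
      rw [div_mul_eq_mul_div, le_div_iff₀ hh0, mul_assoc]
      refine mul_le_mul_of_nonneg_left ?_ (le_max_right _ _)
      rwa [mul_comm]
    have h3 := mul_le_mul_of_nonneg_right (le_max_left γ 0) hA
    rw [sub_mul, one_mul]
    linarith

theorem IsTestFunction.hardySobolevTerm_eq (hn : 3 ≤ n) {s : ℝ} (hs : s ≤ 2)
    {W : Set (EuclideanSpace ℝ (Fin n))} {u : EuclideanSpace ℝ (Fin n) → ℝ}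
    (hu : IsTestFunction W u) : hardySobolevTerm s W u = hardySobolevTerm s Set.univ u := by
  rw [hardySobolevTerm, hardySobolevTerm, Measure.restrict_univ,
    setIntegral_eq_integral_of_forall_compl_eq_zero fun x hx => by
      simp [hu.eq_zero_of_notMem hx, Real.zero_rpow (critExp_pos hn hs).ne']]

/-- On the half-space the Hardy-Sobolev inequality holds for the whole of `D^{1,2}`. -/
theorem exists_halfSpace_hardySobolev [NeZero n] (hn : 3 ≤ n) {γ s : ℝ}
    (hγ : γ < (n : ℝ) ^ 2 / 4) (hs : s ∈ Set.Icc (0 : ℝ) 2) : ∃ c : ℝ, 0 < c ∧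
    ∀ (u : EuclideanSpace ℝ (Fin n) → ℝ) (G : EuclideanSpace ℝ (Fin n) → EuclideanSpace ℝ (Fin n)),
      MemD12 (halfSpace n) u → HasWeakGradientOn (halfSpace n) u G →
      IntegrableOn (fun x => |u x| ^ critExp n s / ‖x‖ ^ s) (halfSpace n) ∧
      c * hardySobolevTerm s (halfSpace n) u ≤
        (∫ x in halfSpace n, ‖G x‖ ^ 2) - γ * ∫ x in halfSpace n, u x ^ 2 / ‖x‖ ^ 2 := by
  obtain ⟨κ, hκ, hcoer⟩ := halfSpace_hardy_coercive (n := n) hγ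
  obtain ⟨C, hC, hHS⟩ := exists_hardySobolev hn hs
  refine ⟨κ / C, by positivity, fun u G hu hG => ?_⟩
  obtain ⟨φ, hφ, hT, hA, hD, -⟩ :=
    hu.exists_approximation hn isOpen_halfSpace zero_notMem_halfSpace hG
  refine ⟨(hT s hs).1, ?_⟩
  have hq := critExp_pos hn hs.2
  refine le_of_tendsto_of_tendsto'
    (((hT s hs).2.rpow_const (p := 2 / critExp n s) (Or.inr (by positivity))).const_mul (κ / C))
    (hD.2.sub (hA.2.const_mul γ)) fun k => ?_
  have h1 := hHS _ _ isOpen_halfSpace zero_notMem_halfSpace (hφ k)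
  simp only [hardySobolevTerm, Measure.restrict_univ] at h1
  refine le_trans ?_ (hcoer _ (hφ k))
  rw [div_mul_eq_mul_div, div_le_iff₀ hC, mul_assoc]
  refine mul_le_mul_of_nonneg_left ?_ hκ.le
  rwa [mul_comm]

theorem hardySobolevTerm_pos (hn : 3 ≤ n) {s : ℝ} (hs : s ∈ Set.Icc (0 : ℝ) 2)
    {W : Set (EuclideanSpace ℝ (Fin n))} (hW : MeasurableSet W)
    (hW0 : (0 : EuclideanSpace ℝ (Fin n)) ∉ W) {u : EuclideanSpace ℝ (Fin n) → ℝ}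
    (hint : IntegrableOn (fun x => |u x| ^ critExp n s / ‖x‖ ^ s) W)
    (hu : ¬ u =ᵐ[volume.restrict W] 0) : 0 < hardySobolevTerm s W u := by
  have hq := critExp_pos hn hs.2
  refine Real.rpow_pos_of_pos
    (lt_of_le_of_ne (integral_nonneg fun x => by positivity) fun h => ?_) _
  refine hu ?_
  have h1 := (integral_eq_zero_iff_of_nonneg (fun x => by positivity) hint).1 h.symm
  filter_upwards [h1, ae_restrict_mem hW] with x hx hxW
  have hx0 : 0 < ‖x‖ ^ s := Real.rpow_pos_of_pos (norm_pos_iff.2 fun h => hW0 (h ▸ hxW)) s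
  simp only [Pi.zero_apply, div_eq_zero_iff, hx0.ne', or_false] at hx
  rw [Real.rpow_eq_zero (abs_nonneg _) hq.ne'] at hx
  exact abs_eq_zero.1 hx

/-- A positive lower bound for the quotients that define the best constant of the half-space. -/
theorem exists_pos_le_functionalJ [NeZero n] (hn : 3 ≤ n) {γ s : ℝ}
    (hγ : γ < (n : ℝ) ^ 2 / 4) (hs : s ∈ Set.Icc (0 : ℝ) 2) : ∃ c : ℝ, 0 < c ∧
    ∀ (u : EuclideanSpace ℝ (Fin n) → ℝ) (G : EuclideanSpace ℝ (Fin n) → EuclideanSpace ℝ (Fin n)),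
      MemD12 (halfSpace n) u → HasWeakGradientOn (halfSpace n) u G →
      ¬ u =ᵐ[volume.restrict (halfSpace n)] 0 → c ≤ functionalJ γ s (halfSpace n) u G := by
  obtain ⟨c, hc, h⟩ := exists_halfSpace_hardySobolev (n := n) hn hγ hs
  refine ⟨c, hc, fun u G hu hG hne => ?_⟩
  rw [functionalJ, le_div_iff₀ (hardySobolevTerm_pos hn hs isOpen_halfSpace.measurableSet
    zero_notMem_halfSpace (h u G hu hG).1 hne)]
  exact (h u G hu hG).2

theorem exists_testFunction_halfSpace [NeZero n] : ∃ u : EuclideanSpace ℝ (Fin n) → ℝ,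
    IsTestFunction (halfSpace n) u ∧ ¬ u =ᵐ[volume.restrict (halfSpace n)] 0 := by
  let e : EuclideanSpace ℝ (Fin n) := EuclideanSpace.single 0 1
  have he : e ∈ halfSpace n := by simp [e, halfSpace]
  obtain ⟨r, hr, hball⟩ := Metric.nhds_basis_closedBall.mem_iff.1 (isOpen_halfSpace.mem_nhds he)
  let b : ContDiffBump e := ⟨r / 2, r, by positivity, by linarith⟩
  refine ⟨b, ⟨b.contDiff, b.hasCompactSupport, by rw [b.tsupport_eq]; exact hball⟩, fun h => ?_⟩
  have h1 := Measure.eqOn_open_of_ae_eq h isOpen_halfSpace b.continuous.continuousOn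
    continuousOn_const
  have h2 : b e = 1 := b.one_of_mem_closedBall (by simp [b.rIn_pos.le])
  have h3 : b e = 0 := h1 he
  rw [h2] at h3
  exact one_ne_zero h3

theorem bestConstant_halfSpace_pos [NeZero n] (hn : 3 ≤ n) {γ s : ℝ}
    (hγ : γ < (n : ℝ) ^ 2 / 4) (hs : s ∈ Set.Icc (0 : ℝ) 2) :
    0 < bestConstant γ s (halfSpace n) := by
  obtain ⟨c, hc, h⟩ := exists_pos_le_functionalJ (n := n) hn hγ hs
  obtain ⟨u, hu, hne⟩ := exists_testFunction_halfSpace (n := n)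
  refine hc.trans_le (le_csInf ⟨_, u, gradient u, hu.memD12, hu.hasWeakGradientOn, hne, rfl⟩ ?_)
  rintro t ⟨v, G, hv, hG, hvne, rfl⟩
  exact h v G hv hG hvne

/-- A test function on the half-space is admissible in the infimum defining the best constant. -/
theorem IsTestFunction.bestConstant_mul_le [NeZero n] (hn : 3 ≤ n) {γ s : ℝ}
    (hγ : γ < (n : ℝ) ^ 2 / 4) (hs : s ∈ Set.Icc (0 : ℝ) 2)
    {u : EuclideanSpace ℝ (Fin n) → ℝ} (hu : IsTestFunction (halfSpace n) u) :
    bestConstant γ s (halfSpace n) * hardySobolevTerm s Set.univ u ≤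
      (∫ x, ‖gradient u x‖ ^ 2) - γ * ∫ x, u x ^ 2 / ‖x‖ ^ 2 := by
  have hq := critExp_pos hn hs.2
  rw [← hu.hardySobolevTerm_eq hn hs.2]
  obtain ⟨c, hc, h⟩ := exists_pos_le_functionalJ (n := n) hn hγ hs
  have hD : ∫ x in halfSpace n, ‖gradient u x‖ ^ 2 = ∫ x, ‖gradient u x‖ ^ 2 :=
    setIntegral_eq_integral_of_forall_compl_eq_zero fun x hx => by
      simp [gradient_eq_zero fun h => hx (hu.tsupport_subset h)]
  have hA : ∫ x in halfSpace n, u x ^ 2 / ‖x‖ ^ 2 = ∫ x, u x ^ 2 / ‖x‖ ^ 2 :=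
    setIntegral_eq_integral_of_forall_compl_eq_zero fun x hx => by
      simp [hu.eq_zero_of_notMem hx]
  by_cases hne : u =ᵐ[volume.restrict (halfSpace n)] 0
  · have h0 : hardySobolevTerm s (halfSpace n) u = 0 := by
      rw [hardySobolevTerm, integral_eq_zero_of_ae, Real.zero_rpow (by positivity)]
      filter_upwards [hne] with x hx
      simp [hx, Real.zero_rpow hq.ne']
    obtain ⟨κ, hκ, hcoer⟩ := halfSpace_hardy_coercive (n := n) hγ
    rw [h0, mul_zero]
    exact (mul_nonneg hκ.le (integral_nonneg fun x => by positivity)).trans (hcoer u hu)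
  · rw [← hD, ← hA, ← le_div_iff₀ (hardySobolevTerm_pos hn hs isOpen_halfSpace.measurableSet
      zero_notMem_halfSpace (hu.integrable_rpow_div zero_notMem_halfSpace hq s).integrableOn hne)]
    refine csInf_le ⟨c, ?_⟩ ⟨u, gradient u, hu.memD12, hu.hasWeakGradientOn, hne, rfl⟩
    rintro t ⟨v, G, hv, hG, hvne, rfl⟩
    exact h v G hv hG hvne

/-- For `s = 0` the best constant of the half-space is at most the Sobolev constant of `ℝⁿ`:
translating a test function to infinity along the inner normal makes its Hardy term vanish. -/
theorem IsTestFunction.bestConstant_mul_le_of_zero [NeZero n] (hn : 3 ≤ n) {γ : ℝ}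
    (hγ : γ < (n : ℝ) ^ 2 / 4) {W : Set (EuclideanSpace ℝ (Fin n))}
    {u : EuclideanSpace ℝ (Fin n) → ℝ} (hu : IsTestFunction W u) :
    bestConstant γ 0 (halfSpace n) * hardySobolevTerm 0 Set.univ u ≤
      ∫ x, ‖gradient u x‖ ^ 2 := by
  obtain ⟨R, hR⟩ := hu.hasCompactSupport.isBounded.subset_closedBall (0 : EuclideanSpace ℝ (Fin n))
  let e : EuclideanSpace ℝ (Fin n) := EuclideanSpace.single 0 1
  have hshift : ∀ t : ℝ, 0 < t → bestConstant γ 0 (halfSpace n) * hardySobolevTerm 0 Set.univ u ≤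
      (∫ x, ‖gradient u x‖ ^ 2) + |γ| * ((∫ x, u x ^ 2) / t ^ 2) := by
    intro t ht
    let c : EuclideanSpace ℝ (Fin n) := (R + t) • e
    have hsupp : tsupport (fun x => u (x - c)) ⊆ (fun x => x - c) ⁻¹' tsupport u :=
      closure_minimal (fun x hx => subset_tsupport u hx)
        ((isClosed_tsupport u).preimage (by fun_prop))
    -- the translated support lies at distance at least `t` from the boundary hyperplane
    have hcoord : ∀ y ∈ tsupport u, t ≤ (y + c) 0 := by
      intro y hy
      have h1 : ‖y‖ ≤ R := by simpa using hR hy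
      have h2 : |y 0| ≤ ‖y‖ := by simpa using PiLp.norm_apply_le y 0
      have h3 : (y + c) 0 = y 0 + (R + t) := by simp [c, e]
      rw [h3]
      linarith [neg_abs_le (y 0)]
    have hv : IsTestFunction (halfSpace n) fun x => u (x - c) := by
      refine ⟨hu.contDiff.comp (contDiff_id.sub contDiff_const), ?_, fun x hx => ?_⟩
      · exact hu.hasCompactSupport.comp_homeomorph (Homeomorph.subRight c)
      · have := hcoord _ (hsupp hx)
        rw [sub_add_cancel] at this
        exact ht.trans_le this
    have hg : ∀ x, gradient (fun x => u (x - c)) x = gradient u (x - c) := by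
      intro x
      rw [gradient, gradient, fderiv_comp_sub]
    have key := hv.bestConstant_mul_le hn hγ (s := 0) ⟨le_rfl, zero_le_two⟩
    simp only [hg, hardySobolevTerm, Measure.restrict_univ, Real.rpow_zero, div_one] at key ⊢
    rw [integral_sub_right_eq_self (fun x => ‖gradient u x‖ ^ 2) c,
      integral_sub_right_eq_self (fun x => |u x| ^ critExp n 0) c] at key
    refine key.trans ?_
    have hA : ∫ x, u (x - c) ^ 2 / ‖x‖ ^ 2 ≤ (∫ x, u x ^ 2) / t ^ 2 := by
      rw [← integral_sub_right_eq_self (fun x => u x ^ 2) c, ← integral_div]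
      refine integral_mono (hv.integrable_sq_div zero_notMem_halfSpace)
        (hv.integrable_sq.div_const _) fun x => ?_
      by_cases hx : x - c ∈ tsupport u
      · have h1 := hcoord _ hx
        rw [sub_add_cancel] at h1
        have h2 : |x 0| ≤ ‖x‖ := by simpa using PiLp.norm_apply_le x 0
        have h3 : t ≤ ‖x‖ := (h1.trans (le_abs_self _)).trans h2
        simp only
        gcongr
      · simp [image_eq_zero_of_notMem_tsupport hx]
    have hA0 : 0 ≤ ∫ x, u (x - c) ^ 2 / ‖x‖ ^ 2 := integral_nonneg fun x => by positivity
    have h1 := mul_le_mul_of_nonneg_left hA (abs_nonneg γ)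
    have h2 := mul_le_mul_of_nonneg_right (neg_abs_le γ) hA0
    linarith
  have hlim : Tendsto (fun t : ℝ => (∫ x, ‖gradient u x‖ ^ 2) + |γ| * ((∫ x, u x ^ 2) / t ^ 2))
      atTop (𝓝 ((∫ x, ‖gradient u x‖ ^ 2) + |γ| * 0)) :=
    tendsto_const_nhds.add ((tendsto_const_nhds.div_atTop
      (tendsto_pow_atTop two_ne_zero)).const_mul _)
  rw [mul_zero, add_zero] at hlim
  exact ge_of_tendsto hlim ((eventually_gt_atTop 0).mono hshift)

/-! ### Straightening the boundary -/

/-- The boundary chart can be precomposed with a linear automorphism of the half-space so that its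
derivative at `0` becomes an isometry. If `M` is the inverse of the derivative of the chart and
`ν` is the vector representing `x ↦ (M x)₁`, an isometry `R` with `R e₁ = ν/|ν|` satisfies
`(M R y)₁ = |ν| y₁`, so that `M R` preserves the half-space. -/
theorem SmoothBoundaryAtZero.exists_isometric_chart [NeZero n]
    {Ω : Set (EuclideanSpace ℝ (Fin n))} (hΩ : SmoothBoundaryAtZero Ω) :
    ∃ (ψ : OpenPartialHomeomorph (EuclideanSpace ℝ (Fin n)) (EuclideanSpace ℝ (Fin n)))
      (R : EuclideanSpace ℝ (Fin n) ≃ₗᵢ[ℝ] EuclideanSpace ℝ (Fin n)),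
      0 ∈ ψ.source ∧ ψ 0 = 0 ∧ ContDiffOn ℝ ∞ ψ ψ.source ∧
      (∀ y ∈ ψ.source, ψ y ∈ Ω → y ∈ halfSpace n) ∧
      HasFDerivAt ψ
        (R.toContinuousLinearEquiv : EuclideanSpace ℝ (Fin n) →L[ℝ] EuclideanSpace ℝ (Fin n))
        0 := by
  obtain ⟨φ, h0, hφ0, hφ, hφs, himg, -⟩ := hΩ
  have h0t : (0 : EuclideanSpace ℝ (Fin n)) ∈ φ.target := by simpa [hφ0] using φ.map_source h0
  have hs0 : φ.symm 0 = 0 := by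
    have := φ.left_inv h0
    rwa [hφ0] at this
  have hd : HasFDerivAt φ (fderiv ℝ φ 0) 0 :=
    ((hφ.contDiffAt (φ.open_source.mem_nhds h0)).differentiableAt (by simp)).hasFDerivAt
  have hds : HasFDerivAt φ.symm (fderiv ℝ φ.symm 0) 0 :=
    ((hφs.contDiffAt (φ.open_target.mem_nhds h0t)).differentiableAt (by simp)).hasFDerivAt
  set L := fderiv ℝ φ 0
  set M := fderiv ℝ φ.symm 0
  have hML : M.comp L = ContinuousLinearMap.id ℝ _ := by
    have h1 : HasFDerivAt (φ.symm ∘ φ) (M.comp L) 0 := HasFDerivAt.comp 0 (by rwa [hφ0]) hd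
    refine h1.unique ((hasFDerivAt_id 0).congr_of_eventuallyEq ?_)
    filter_upwards [φ.open_source.mem_nhds h0] with x hx using φ.left_inv hx
  have hLM : L.comp M = ContinuousLinearMap.id ℝ _ := by
    have h1 : HasFDerivAt (φ ∘ φ.symm) (L.comp M) 0 := HasFDerivAt.comp 0 (by rwa [hs0]) hds
    refine h1.unique ((hasFDerivAt_id 0).congr_of_eventuallyEq ?_)
    filter_upwards [φ.open_target.mem_nhds h0t] with x hx using φ.right_inv hx
  let Me : EuclideanSpace ℝ (Fin n) ≃L[ℝ] EuclideanSpace ℝ (Fin n) :=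
    ContinuousLinearEquiv.equivOfInverse M L (fun x => DFunLike.congr_fun hLM x)
      (fun x => DFunLike.congr_fun hML x)
  let ℓ : EuclideanSpace ℝ (Fin n) →L[ℝ] ℝ := (EuclideanSpace.proj 0).comp M
  let ν := (InnerProductSpace.toDual ℝ (EuclideanSpace ℝ (Fin n))).symm ℓ
  have hν : ∀ x, inner ℝ ν x = (M x) 0 := fun x => by
    simp [ν, ℓ, InnerProductSpace.toDual_symm_apply]
  let e : EuclideanSpace ℝ (Fin n) := EuclideanSpace.single 0 1
  have he : ‖e‖ = 1 := by simp [e]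
  have hν0 : 0 < ‖ν‖ := by
    rw [norm_pos_iff]
    intro h
    have h1 := hν (L e)
    have h2 : M (L e) = e := DFunLike.congr_fun hML e
    rw [h, inner_zero_left, h2] at h1
    simp [e] at h1
  let R := (ℝ ∙ (e - ‖ν‖⁻¹ • ν))ᗮ.reflection
  have hRe : R e = ‖ν‖⁻¹ • ν := Submodule.reflection_sub (by
    rw [he, norm_smul, norm_inv, norm_norm, inv_mul_cancel₀ hν0.ne'])
  have hR : ∀ y, (M (R y)) 0 = ‖ν‖ * y 0 := by
    intro y
    have h1 : ν = ‖ν‖ • R e := by rw [hRe, smul_smul, mul_inv_cancel₀ hν0.ne', one_smul]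
    rw [← hν, h1, inner_smul_left, R.inner_map_map, ← h1]
    simp [e, EuclideanSpace.inner_single_left]
  let A : EuclideanSpace ℝ (Fin n) ≃L[ℝ] EuclideanSpace ℝ (Fin n) :=
    R.toContinuousLinearEquiv.trans Me
  have hA : ∀ y, A y = M (R y) := fun y => rfl
  refine ⟨A.toHomeomorph.transOpenPartialHomeomorph φ, R, ?_, ?_, ?_, ?_, ?_⟩
  · simpa using h0
  · simpa using hφ0
  · exact hφ.comp A.contDiff.contDiffOn fun x hx => hx
  · intro y hy hyΩ
    have hys : A y ∈ φ.source := hy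
    have hyΩ' : φ (A y) ∈ φ.target ∩ Ω := ⟨φ.map_source hys, hyΩ⟩
    rw [← himg] at hyΩ'
    obtain ⟨z, ⟨hzs, hzH⟩, hz⟩ := hyΩ'
    have hzA : z = A y := φ.injOn hzs hys hz
    have h1 : 0 < (A y) 0 := hzA ▸ hzH
    rw [hA, hR] at h1
    exact (mul_pos_iff_of_pos_left hν0).1 h1
  · have h1 : HasFDerivAt (φ ∘ A) (L.comp (A : EuclideanSpace ℝ (Fin n) →L[ℝ] _)) 0 :=
      HasFDerivAt.comp 0 (by rwa [map_zero]) A.hasFDerivAt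
    have h2 : L.comp (A : EuclideanSpace ℝ (Fin n) →L[ℝ] EuclideanSpace ℝ (Fin n)) =
        (R.toContinuousLinearEquiv : EuclideanSpace ℝ (Fin n) →L[ℝ] EuclideanSpace ℝ (Fin n)) :=
      ContinuousLinearMap.ext fun x => DFunLike.congr_fun hLM (R x)
    rw [h2] at h1
    exact h1

theorem abs_det_linearIsometryEquiv
    (R : EuclideanSpace ℝ (Fin n) ≃ₗᵢ[ℝ] EuclideanSpace ℝ (Fin n)) :
    |(R.toContinuousLinearEquiv :
      EuclideanSpace ℝ (Fin n) →L[ℝ] EuclideanSpace ℝ (Fin n)).det| = 1 := by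
  have h1 := R.toLinearIsometry.normDet_eq_one
  rw [LinearMap.normDet_eq_abs_det] at h1
  exact h1

/-- Near `0`, a map whose derivative at `0` is an isometry distorts volumes, norms and gradients by
a factor close to `1`. -/
theorem exists_almost_isometric_ball
    {ψ : OpenPartialHomeomorph (EuclideanSpace ℝ (Fin n)) (EuclideanSpace ℝ (Fin n))}
    (h0 : 0 ∈ ψ.source) (hψ0 : ψ 0 = 0) (hψ : ContDiffOn ℝ ∞ ψ ψ.source)
    {R : EuclideanSpace ℝ (Fin n) ≃ₗᵢ[ℝ] EuclideanSpace ℝ (Fin n)}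
    (hR : HasFDerivAt ψ
      (R.toContinuousLinearEquiv : EuclideanSpace ℝ (Fin n) →L[ℝ] EuclideanSpace ℝ (Fin n)) 0)
    {l : ℝ} (hl : 1 < l) :
    ∃ ρ : ℝ, 0 < ρ ∧ Metric.ball 0 ρ ⊆ ψ.source ∧ ∀ y ∈ Metric.ball 0 ρ,
      l⁻¹ ≤ |(fderiv ℝ ψ y).det| ∧ |(fderiv ℝ ψ y).det| ≤ l ∧ ‖fderiv ℝ ψ y‖ ≤ l ∧
      ‖y‖ ≤ l * ‖ψ y‖ ∧ ‖ψ y‖ ≤ l * ‖y‖ := by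
  have hl0 : 0 < l := zero_lt_one.trans hl
  have hli : l⁻¹ < 1 := inv_lt_one_of_one_lt₀ hl
  have hc : ContinuousAt (fderiv ℝ ψ) 0 :=
    (hψ.continuousOn_fderiv_of_isOpen ψ.open_source (by simp)).continuousAt
      (ψ.open_source.mem_nhds h0)
  have hdet : ContinuousAt (fun y => |(fderiv ℝ ψ y).det|) 0 :=
    (ContinuousLinearMap.continuous_det.continuousAt.comp hc).abs
  have hdet0 : |(fderiv ℝ ψ 0).det| = 1 := by rw [hR.fderiv, abs_det_linearIsometryEquiv]
  have hnorm0 : ‖fderiv ℝ ψ 0‖ < l := by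
    rw [hR.fderiv]
    refine lt_of_le_of_lt (ContinuousLinearMap.opNorm_le_bound _ zero_le_one fun x => ?_) hl
    simp
  have hlo := hR.isLittleO.def (c := 1 - l⁻¹) (by linarith)
  have hev : ∀ᶠ y in 𝓝 (0 : EuclideanSpace ℝ (Fin n)), y ∈ ψ.source ∧
      l⁻¹ ≤ |(fderiv ℝ ψ y).det| ∧ |(fderiv ℝ ψ y).det| ≤ l ∧ ‖fderiv ℝ ψ y‖ ≤ l ∧
      ‖y‖ ≤ l * ‖ψ y‖ ∧ ‖ψ y‖ ≤ l * ‖y‖ := by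
    filter_upwards [ψ.open_source.mem_nhds h0,
      hdet.eventually (lt_mem_nhds (show l⁻¹ < |(fderiv ℝ ψ 0).det| by rwa [hdet0])),
      hdet.eventually (gt_mem_nhds (show |(fderiv ℝ ψ 0).det| < l by rwa [hdet0])),
      hc.norm.eventually (gt_mem_nhds hnorm0), hlo] with y h1 h2 h3 h4 h5
    refine ⟨h1, h2.le, h3.le, h4.le, ?_⟩
    rw [hψ0, sub_zero, sub_zero] at h5
    have hRy : ‖R y‖ = ‖y‖ := R.norm_map y
    have h5' : ‖ψ y - R y‖ ≤ (1 - l⁻¹) * ‖y‖ := h5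
    have h6 : ‖ψ y‖ ≤ ‖y‖ + (1 - l⁻¹) * ‖y‖ := by
      rw [← hRy] at h5' ⊢
      linarith [norm_sub_norm_le (ψ y) (R y)]
    have h7 : ‖y‖ ≤ ‖ψ y‖ + (1 - l⁻¹) * ‖y‖ := by
      have := norm_sub_norm_le (R y) (ψ y)
      rw [norm_sub_rev] at this
      rw [← hRy] at h5' ⊢
      linarith
    have hy := norm_nonneg y
    constructor
    · have : l⁻¹ * ‖y‖ ≤ ‖ψ y‖ := by linarith
      rwa [inv_mul_le_iff₀ hl0] at this
    · have : 1 - l⁻¹ ≤ l - 1 := by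
        have h8 : l * l⁻¹ = 1 := mul_inv_cancel₀ hl0.ne'
        nlinarith
      nlinarith
  obtain ⟨ρ, hρ, hball⟩ := Metric.eventually_nhds_iff_ball.1 hev
  exact ⟨ρ, hρ, fun y hy => (hball y hy).1, fun y hy => (hball y hy).2⟩

/-- Change of variables `x = ψ y` on `N`, as an upper bound for an integral on the `y` side. -/
theorem integral_le_of_comp_le {N : Set (EuclideanSpace ℝ (Fin n))} (hN : MeasurableSet N)
    {ψ : EuclideanSpace ℝ (Fin n) → EuclideanSpace ℝ (Fin n)}
    (hψ : ∀ y ∈ N, DifferentiableAt ℝ ψ y) (hinj : Set.InjOn ψ N) {l c : ℝ} (hl : 0 < l)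
    (hc : 0 ≤ c)
    (hdet : ∀ y ∈ N, l⁻¹ ≤ |(fderiv ℝ ψ y).det|) {f g : EuclideanSpace ℝ (Fin n) → ℝ}
    (hf : Integrable f) (hf0 : ∀ x, 0 ≤ f x) (hg : Integrable g) (hg0 : ∀ y, y ∉ N → g y = 0)
    (h : ∀ y ∈ N, g y ≤ c * f (ψ y)) : ∫ y, g y ≤ c * l * ∫ x, f x := by
  have hd : ∀ y ∈ N, HasFDerivWithinAt ψ (fderiv ℝ ψ y) N y := fun y hy =>
    (hψ y hy).hasFDerivAt.hasFDerivWithinAt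
  have hint := (integrableOn_image_iff_integrableOn_abs_det_fderiv_smul volume hN hd hinj f).1
    hf.integrableOn
  calc ∫ y, g y = ∫ y in N, g y := (setIntegral_eq_integral_of_forall_compl_eq_zero hg0).symm
    _ ≤ ∫ y in N, c * l * (|(fderiv ℝ ψ y).det| • f (ψ y)) := by
        refine setIntegral_mono_on hg.integrableOn (hint.const_mul _) hN fun y hy => ?_
        refine (h y hy).trans ?_
        have h1 := hdet y hy
        rw [inv_le_iff_one_le_mul₀' hl] at h1
        have h2 := mul_le_mul_of_nonneg_right h1 (mul_nonneg hc (hf0 (ψ y)))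
        rw [smul_eq_mul]
        linarith
    _ = c * l * ∫ x in ψ '' N, f x := by
        rw [integral_const_mul, integral_image_eq_integral_abs_det_fderiv_smul volume hN hd hinj]
    _ ≤ c * l * ∫ x, f x := mul_le_mul_of_nonneg_left
        (setIntegral_le_integral hf (ae_of_all _ hf0)) (mul_nonneg hc hl.le)

/-- Change of variables `x = ψ y` on `N`, as an upper bound for an integral on the `x` side. -/
theorem integral_le_of_le_comp {N : Set (EuclideanSpace ℝ (Fin n))} (hN : MeasurableSet N)
    {ψ : EuclideanSpace ℝ (Fin n) → EuclideanSpace ℝ (Fin n)}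
    (hψ : ∀ y ∈ N, DifferentiableAt ℝ ψ y) (hinj : Set.InjOn ψ N) {l c : ℝ} (hl : 0 < l)
    (hc : 0 ≤ c)
    (hdet : ∀ y ∈ N, |(fderiv ℝ ψ y).det| ≤ l) {f g : EuclideanSpace ℝ (Fin n) → ℝ}
    (hf : Integrable f) (hf0 : ∀ x, 0 ≤ f x) (hfN : ∀ x, x ∉ ψ '' N → f x = 0)
    (hg : Integrable g) (hg0 : ∀ y, 0 ≤ g y)
    (h : ∀ y ∈ N, f (ψ y) ≤ c * g y) : ∫ x, f x ≤ c * l * ∫ y, g y := by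
  have hd : ∀ y ∈ N, HasFDerivWithinAt ψ (fderiv ℝ ψ y) N y := fun y hy =>
    (hψ y hy).hasFDerivAt.hasFDerivWithinAt
  have hint := (integrableOn_image_iff_integrableOn_abs_det_fderiv_smul volume hN hd hinj f).1
    hf.integrableOn
  calc ∫ x, f x = ∫ y in N, |(fderiv ℝ ψ y).det| • f (ψ y) := by
        rw [← integral_image_eq_integral_abs_det_fderiv_smul volume hN hd hinj,
          setIntegral_eq_integral_of_forall_compl_eq_zero hfN]
    _ ≤ ∫ y in N, c * l * g y := by
        refine setIntegral_mono_on hint (hg.const_mul _).integrableOn hN fun y hy => ?_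
        have h1 := mul_le_mul (hdet y hy) (h y hy) (hf0 _) hl.le
        rw [smul_eq_mul]
        linarith
    _ = c * l * ∫ y in N, g y := integral_const_mul _ _
    _ ≤ c * l * ∫ y, g y := mul_le_mul_of_nonneg_left
        (setIntegral_le_integral hg (ae_of_all _ hg0)) (mul_nonneg hc hl.le)

/-! ### The inequality near the origin -/

/-- A test function on `Ω` supported near `0` is transplanted to the half-space by the boundary
chart, with all integrals changed by a factor close to `1`. -/
theorem SmoothBoundaryAtZero.exists_transplantation [NeZero n] (hn : 3 ≤ n)
    {Ω : Set (EuclideanSpace ℝ (Fin n))} (hΩ : SmoothBoundaryAtZero Ω)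
    (h0Ω : (0 : EuclideanSpace ℝ (Fin n)) ∉ Ω) {l : ℝ} (hl : 1 < l) :
    ∃ δ : ℝ, 0 < δ ∧ ∀ u : EuclideanSpace ℝ (Fin n) → ℝ, IsTestFunction Ω u →
      tsupport u ⊆ Metric.ball 0 δ → ∃ v : EuclideanSpace ℝ (Fin n) → ℝ,
        IsTestFunction (halfSpace n) v ∧
        ∫ x, ‖gradient v x‖ ^ 2 ≤ l ^ 3 * ∫ x, ‖gradient u x‖ ^ 2 ∧
        ∫ x, v x ^ 2 / ‖x‖ ^ 2 ≤ l ^ 3 * ∫ x, u x ^ 2 / ‖x‖ ^ 2 ∧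
        ∫ x, u x ^ 2 / ‖x‖ ^ 2 ≤ l ^ 3 * ∫ x, v x ^ 2 / ‖x‖ ^ 2 ∧
        ∀ s ∈ Set.Icc (0 : ℝ) 2, ∫ x, |u x| ^ critExp n s / ‖x‖ ^ s ≤
          l ^ 3 * ∫ x, |v x| ^ critExp n s / ‖x‖ ^ s := by
  obtain ⟨ψ, R, h0, hψ0, hψ, hψΩ, hR⟩ := hΩ.exists_isometric_chart
  obtain ⟨ρ, hρ, hNs, hN⟩ := exists_almost_isometric_ball h0 hψ0 hψ hR hl
  set N := Metric.ball (0 : EuclideanSpace ℝ (Fin n)) ρ with hNdef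
  have hl0 : 0 < l := zero_lt_one.trans hl
  have hNo : IsOpen N := Metric.isOpen_ball
  have hψd : ∀ y ∈ N, ContDiffAt ℝ ∞ ψ y := fun y hy =>
    hψ.contDiffAt (ψ.open_source.mem_nhds (hNs hy))
  have hψd1 : ∀ y ∈ N, DifferentiableAt ℝ ψ y := fun y hy => (hψd y hy).differentiableAt (by simp)
  have hinj : Set.InjOn ψ N := ψ.injOn.mono hNs
  have hVo : IsOpen (ψ '' N) := ψ.isOpen_image_of_subset_source hNo hNs
  obtain ⟨δ, hδ, hδV⟩ := Metric.isOpen_iff.1 hVo 0 ⟨0, Metric.mem_ball_self hρ, hψ0⟩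
  refine ⟨δ, hδ, fun u hu husupp => ?_⟩
  have hKV : tsupport u ⊆ ψ '' N := husupp.trans hδV
  have hKt : tsupport u ⊆ ψ.target := hKV.trans (by
    rintro _ ⟨y, hy, rfl⟩
    exact ψ.map_source (hNs hy))
  let v : EuclideanSpace ℝ (Fin n) → ℝ := N.indicator (u ∘ ψ)
  have hvN : ∀ y ∈ N, v y = u (ψ y) := fun y hy => Set.indicator_of_mem hy _
  have hv0 : ∀ y, y ∉ N → v y = 0 := fun y hy => Set.indicator_of_notMem hy _
  have hK'c : IsCompact (ψ.symm '' tsupport u) :=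
    hu.hasCompactSupport.image_of_continuousOn (ψ.continuousOn_symm.mono hKt)
  have hvsupp : tsupport v ⊆ ψ.symm '' tsupport u := by
    refine closure_minimal (fun y hy => ?_) hK'c.isClosed
    by_cases hyN : y ∈ N
    · refine ⟨ψ y, subset_tsupport u ?_, ψ.left_inv (hNs hyN)⟩
      have : v y ≠ 0 := hy
      rwa [hvN y hyN] at this
    · exact absurd (hv0 y hyN) hy
  have hK'N : ψ.symm '' tsupport u ⊆ N := by
    rintro _ ⟨x, hx, rfl⟩
    obtain ⟨y, hy, rfl⟩ := hKV hx
    rwa [ψ.left_inv (hNs hy)]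
  have hvt : IsTestFunction (halfSpace n) v := by
    refine ⟨contDiff_iff_contDiffAt.2 fun y => ?_, hK'c.of_isClosed_subset
      (isClosed_tsupport v) hvsupp, fun y hy => ?_⟩
    · by_cases hy : y ∈ tsupport v
      · have hyN : y ∈ N := hK'N (hvsupp hy)
        refine ((hu.contDiff.contDiffAt).comp y (hψd y hyN)).congr_of_eventuallyEq ?_
        filter_upwards [hNo.mem_nhds hyN] with z hz using hvN z hz
      · exact contDiffAt_const.congr_of_eventuallyEq (notMem_tsupport_iff_eventuallyEq.1 hy)
    · obtain ⟨x, hx, rfl⟩ := hvsupp hy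
      refine hψΩ _ (ψ.map_target (hKt hx)) ?_
      rw [ψ.right_inv (hKt hx)]
      exact hu.tsupport_subset hx
  have hpos : ∀ y ∈ N, y ≠ 0 → 0 < ‖y‖ ∧ 0 < ‖ψ y‖ := by
    intro y hy hy0
    have h1 : 0 < ‖y‖ := norm_pos_iff.2 hy0
    have h2 := (hN y hy).2.2.2.1
    exact ⟨h1, pos_of_mul_pos_right (h1.trans_le h2) hl0.le⟩
  have hz : u (ψ 0) = 0 := by
    rw [hψ0]
    exact hu.eq_zero_of_notMem h0Ω
  have huN : ∀ x, x ∉ ψ '' N → u x = 0 := fun x hx =>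
    image_eq_zero_of_notMem_tsupport fun h => hx (hKV h)
  refine ⟨v, hvt, ?_, ?_, ?_, fun s hs => ?_⟩
  · have := integral_le_of_comp_le hNo.measurableSet hψd1 hinj hl0 (sq_nonneg l)
      (fun y hy => (hN y hy).1) hu.integrable_norm_gradient_sq (fun x => sq_nonneg _)
      hvt.integrable_norm_gradient_sq
      (fun y hy => by
        rw [IsTestFunction.gradient_eq_zero fun h => hy (hK'N (hvsupp h))]; simp)
      (fun y hy => by
        have h1 : fderiv ℝ v y = (fderiv ℝ u (ψ y)).comp (fderiv ℝ ψ y) := by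
          rw [← fderiv_comp y (hu.differentiable _) (hψd1 y hy)]
          refine Filter.EventuallyEq.fderiv_eq ?_
          filter_upwards [hNo.mem_nhds hy] with z hz using hvN z hz
        have h2 : ‖gradient v y‖ ≤ l * ‖gradient u (ψ y)‖ := by
          simp only [gradient, LinearIsometryEquiv.norm_map, h1]
          refine (ContinuousLinearMap.opNorm_comp_le _ _).trans ?_
          rw [mul_comm]
          exact mul_le_mul_of_nonneg_right (hN y hy).2.2.1 (norm_nonneg _)
        rw [← mul_pow]
        exact pow_le_pow_left₀ (norm_nonneg _) h2 2)
    calc _ ≤ l ^ 2 * l * ∫ x, ‖gradient u x‖ ^ 2 := this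
      _ = _ := by ring
  · have := integral_le_of_comp_le hNo.measurableSet hψd1 hinj hl0 (sq_nonneg l)
      (fun y hy => (hN y hy).1) (hu.integrable_sq_div h0Ω) (fun x => by positivity)
      (hvt.integrable_sq_div zero_notMem_halfSpace) (fun y hy => by simp [hv0 y hy])
      (fun y hy => by
        rw [hvN y hy]
        by_cases hy0 : y = 0
        · rw [hy0, hz]; simp
        obtain ⟨p1, p2⟩ := hpos y hy hy0
        rw [mul_div_assoc', div_le_div_iff₀ (by positivity) (by positivity)]
        have h1 := pow_le_pow_left₀ (norm_nonneg _) (hN y hy).2.2.2.2 2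
        calc u (ψ y) ^ 2 * ‖ψ y‖ ^ 2 ≤ u (ψ y) ^ 2 * (l * ‖y‖) ^ 2 :=
              mul_le_mul_of_nonneg_left h1 (sq_nonneg _)
          _ = _ := by ring)
    calc _ ≤ l ^ 2 * l * ∫ x, u x ^ 2 / ‖x‖ ^ 2 := this
      _ = _ := by ring
  · have := integral_le_of_le_comp hNo.measurableSet hψd1 hinj hl0 (sq_nonneg l)
      (fun y hy => (hN y hy).2.1) (hu.integrable_sq_div h0Ω) (fun x => by positivity)
      (fun x hx => by simp [huN x hx])
      (hvt.integrable_sq_div zero_notMem_halfSpace) (fun x => by positivity)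
      (fun y hy => by
        rw [hvN y hy]
        by_cases hy0 : y = 0
        · rw [hy0, hz]; simp
        obtain ⟨p1, p2⟩ := hpos y hy hy0
        rw [mul_div_assoc', div_le_div_iff₀ (by positivity) (by positivity)]
        have h1 := pow_le_pow_left₀ (norm_nonneg _) (hN y hy).2.2.2.1 2
        calc u (ψ y) ^ 2 * ‖y‖ ^ 2 ≤ u (ψ y) ^ 2 * (l * ‖ψ y‖) ^ 2 :=
              mul_le_mul_of_nonneg_left h1 (sq_nonneg _)
          _ = _ := by ring)
    calc _ ≤ l ^ 2 * l * ∫ x, v x ^ 2 / ‖x‖ ^ 2 := this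
      _ = _ := by ring
  · have hq := critExp_pos hn hs.2
    have := integral_le_of_le_comp hNo.measurableSet hψd1 hinj hl0 (sq_nonneg l)
      (fun y hy => (hN y hy).2.1) (hu.integrable_rpow_div h0Ω hq s) (fun x => by positivity)
      (fun x hx => by simp [huN x hx, Real.zero_rpow hq.ne'])
      (hvt.integrable_rpow_div zero_notMem_halfSpace hq s) (fun x => by positivity)
      (fun y hy => by
        rw [hvN y hy]
        by_cases hy0 : y = 0
        · rw [hy0, hz]; simp [Real.zero_rpow hq.ne']
        obtain ⟨p1, p2⟩ := hpos y hy hy0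
        have h1 : ‖y‖ ^ s ≤ l ^ 2 * ‖ψ y‖ ^ s := by
          calc ‖y‖ ^ s ≤ (l * ‖ψ y‖) ^ s := Real.rpow_le_rpow p1.le (hN y hy).2.2.2.1 hs.1
            _ = l ^ s * ‖ψ y‖ ^ s := Real.mul_rpow hl0.le p2.le
            _ ≤ l ^ 2 * ‖ψ y‖ ^ s := by
                refine mul_le_mul_of_nonneg_right ?_ (by positivity)
                rw [← Real.rpow_two]
                exact Real.rpow_le_rpow_of_exponent_le hl.le hs.2
        rw [mul_div_assoc', div_le_div_iff₀ (by positivity) (by positivity)]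
        calc |u (ψ y)| ^ critExp n s * ‖y‖ ^ s
            ≤ |u (ψ y)| ^ critExp n s * (l ^ 2 * ‖ψ y‖ ^ s) :=
              mul_le_mul_of_nonneg_left h1 (by positivity)
          _ = _ := by ring)
    calc _ ≤ l ^ 2 * l * ∫ x, |v x| ^ critExp n s / ‖x‖ ^ s := this
      _ = _ := by ring

theorem eventually_one_lt_and {p : ℝ → Prop} (h : ∀ᶠ x in 𝓝 (1 : ℝ), p x) : ∃ x, 1 < x ∧ p x :=
  ((h.filter_mono nhdsWithin_le_nhds).and (self_mem_nhdsWithin (s := Set.Ioi (1 : ℝ)))).exists.imp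
    fun _ hx => ⟨hx.2, hx.1⟩

/-- Near `0` the sharp inequality of the half-space holds on `Ω` up to `ε`, without a lower order
term. -/
theorem SmoothBoundaryAtZero.exists_local_inequality [NeZero n] (hn : 3 ≤ n) {γ s : ℝ}
    (hγ : γ < (n : ℝ) ^ 2 / 4) (hs : s ∈ Set.Icc (0 : ℝ) 2)
    {Ω : Set (EuclideanSpace ℝ (Fin n))} (hΩ : SmoothBoundaryAtZero Ω) (hΩo : IsOpen Ω)
    (h0Ω : (0 : EuclideanSpace ℝ (Fin n)) ∉ Ω) {ε : ℝ} (hε : 0 < ε) :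
    ∃ δ : ℝ, 0 < δ ∧ ∀ u : EuclideanSpace ℝ (Fin n) → ℝ, IsTestFunction Ω u →
      tsupport u ⊆ Metric.ball 0 δ →
      hardySobolevTerm s Set.univ u ≤ ((bestConstant γ s (halfSpace n))⁻¹ + ε) *
        ((∫ x, ‖gradient u x‖ ^ 2) - γ * ∫ x, u x ^ 2 / ‖x‖ ^ 2) := by
  have hn0 : (0 : ℝ) < n := by exact_mod_cast Nat.pos_of_ne_zero (NeZero.ne n)
  have hμ := bestConstant_halfSpace_pos hn hγ hs
  set μ := bestConstant γ s (halfSpace n)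
  set h := (n : ℝ) ^ 2 / 4 with hh
  have hh0 : 0 < h := by positivity
  have hq := critExp_pos hn hs.2
  have hκ : 0 < 1 - max γ 0 / h := by
    rw [sub_pos, div_lt_one hh0]
    exact max_lt hγ hh0
  set κ := 1 - max γ 0 / h with hκdef
  set M := (1 + 4 * |γ|) * (2 / κ) with hM
  -- the distortion `l` is chosen so close to `1` that the form stays coercive and that the total
  -- loss in the constant is below `ε`
  have hev1 : ∀ᶠ l in 𝓝 (1 : ℝ), max γ 0 / h * (l ^ 3 * l ^ 3) < 1 - κ / 2 := by
    have hc : ContinuousAt (fun l : ℝ => max γ 0 / h * (l ^ 3 * l ^ 3)) 1 := by fun_prop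
    refine hc.eventually (gt_mem_nhds ?_)
    simp only [one_pow, mul_one]
    linarith
  have hev2 : ∀ᶠ l in 𝓝 (1 : ℝ), l ^ 3 * (μ⁻¹ * (1 + (l ^ 3 - 1) * M)) < μ⁻¹ + ε := by
    have hc : ContinuousAt (fun l : ℝ => l ^ 3 * (μ⁻¹ * (1 + (l ^ 3 - 1) * M))) 1 := by fun_prop
    refine hc.eventually (gt_mem_nhds ?_)
    simp only [one_pow, sub_self, zero_mul, add_zero, mul_one, one_mul]
    linarith
  obtain ⟨l, hl, hl1, hl2⟩ := eventually_one_lt_and (hev1.and hev2)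
  obtain ⟨δ, hδ, H⟩ := hΩ.exists_transplantation hn h0Ω hl
  refine ⟨δ, hδ, fun u hu hsupp => ?_⟩
  obtain ⟨v, hv, hD, hA1, hA2, hT⟩ := H u hu hsupp
  have hT := hT s hs
  have hHv := hardy_halfSpace hv
  have hbest := hv.bestConstant_mul_le hn hγ hs
  have hAu4 := hu.integral_sq_div_le hn hΩo h0Ω
  have hTT : hardySobolevTerm s Set.univ u ≤ l ^ 3 * hardySobolevTerm s Set.univ v := by
    simp only [hardySobolevTerm, Measure.restrict_univ]
    have hI : 0 ≤ ∫ x, |v x| ^ critExp n s / ‖x‖ ^ s := integral_nonneg fun x => by positivity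
    have h1l : 1 ≤ l ^ 3 := one_le_pow₀ hl.le
    calc (∫ x, |u x| ^ critExp n s / ‖x‖ ^ s) ^ (2 / critExp n s)
        ≤ (l ^ 3 * ∫ x, |v x| ^ critExp n s / ‖x‖ ^ s) ^ (2 / critExp n s) :=
          Real.rpow_le_rpow (integral_nonneg fun x => by positivity) hT (by positivity)
      _ = (l ^ 3) ^ (2 / critExp n s) *
          (∫ x, |v x| ^ critExp n s / ‖x‖ ^ s) ^ (2 / critExp n s) :=
          Real.mul_rpow (by positivity) hI
      _ ≤ l ^ 3 * (∫ x, |v x| ^ critExp n s / ‖x‖ ^ s) ^ (2 / critExp n s) := by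
          refine mul_le_mul_of_nonneg_right ?_ (Real.rpow_nonneg hI _)
          calc (l ^ 3) ^ (2 / critExp n s) ≤ (l ^ 3) ^ (1 : ℝ) :=
                Real.rpow_le_rpow_of_exponent_le h1l (by
                  rw [div_le_one hq]
                  exact two_le_critExp hn hs.2)
            _ = l ^ 3 := Real.rpow_one _
  have hDu : 0 ≤ ∫ x, ‖gradient u x‖ ^ 2 := integral_nonneg fun x => by positivity
  have hAu : 0 ≤ ∫ x, u x ^ 2 / ‖x‖ ^ 2 := integral_nonneg fun x => by positivity
  set Du := ∫ x, ‖gradient u x‖ ^ 2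
  set Dv := ∫ x, ‖gradient v x‖ ^ 2
  set Au := ∫ x, u x ^ 2 / ‖x‖ ^ 2
  set Av := ∫ x, v x ^ 2 / ‖x‖ ^ 2
  set Tu := hardySobolevTerm s Set.univ u
  set Tv := hardySobolevTerm s Set.univ v
  have ht : 1 ≤ l ^ 3 := one_le_pow₀ hl.le
  set t := l ^ 3
  have ht0 : 0 < t := by linarith
  -- coercivity on `Ω` near the origin, inherited from the half-space
  have hcoer : κ / 2 * Du ≤ Du - γ * Au := by
    have h1 : Au ≤ t * t / h * Du := by
      rw [div_mul_eq_mul_div, le_div_iff₀ hh0]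
      calc Au * h ≤ (t * Av) * h := mul_le_mul_of_nonneg_right hA2 hh0.le
        _ = t * (h * Av) := by ring
        _ ≤ t * (t * Du) := mul_le_mul_of_nonneg_left (hHv.trans hD) ht0.le
        _ = _ := by ring
    have h2 : γ * Au ≤ max γ 0 * Au := mul_le_mul_of_nonneg_right (le_max_left _ _) hAu
    have h3 : max γ 0 * Au ≤ max γ 0 * (t * t / h * Du) :=
      mul_le_mul_of_nonneg_left h1 (le_max_right _ _)
    have h4 : max γ 0 * (t * t / h * Du) = max γ 0 / h * (t * t) * Du := by ring
    have h5 := mul_le_mul_of_nonneg_right hl1.le hDu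
    linarith
  have hAbs : |Au - Av| ≤ (t - 1) * Au := by
    rw [abs_le]
    constructor
    · linarith
    · have h1 : Au ≤ t * Av := hA2
      have h2 : Au - Av ≤ (t - 1) * Av := by linarith
      by_cases h3 : Av ≤ Au
      · exact h2.trans (mul_le_mul_of_nonneg_left h3 (by linarith))
      · have : 0 ≤ (t - 1) * Au := mul_nonneg (by linarith) hAu
        linarith
  have hQ : Dv - γ * Av ≤ (1 + (t - 1) * M) * (Du - γ * Au) := by
    have h1 : γ * (Au - Av) ≤ |γ| * ((t - 1) * Au) := by
      calc γ * (Au - Av) ≤ |γ * (Au - Av)| := le_abs_self _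
        _ = |γ| * |Au - Av| := abs_mul _ _
        _ ≤ _ := mul_le_mul_of_nonneg_left hAbs (abs_nonneg γ)
    have h2 : Du ≤ 2 / κ * (Du - γ * Au) := by
      rw [div_mul_eq_mul_div, le_div_iff₀ hκ]
      linarith
    have h3 : Du + |γ| * Au ≤ M * (Du - γ * Au) := by
      have h4 : |γ| * Au ≤ |γ| * (4 * Du) := mul_le_mul_of_nonneg_left hAu4 (abs_nonneg γ)
      have h5 := mul_le_mul_of_nonneg_left h2 (show 0 ≤ 1 + 4 * |γ| by positivity)
      rw [hM, mul_assoc]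
      linarith
    have h4 := mul_le_mul_of_nonneg_left h3 (show 0 ≤ t - 1 by linarith)
    have h5 : (1 + (t - 1) * M) * (Du - γ * Au)
        = (Du - γ * Au) + (t - 1) * (M * (Du - γ * Au)) := by ring
    rw [h5]
    nlinarith
  have hQ0 : 0 ≤ Du - γ * Au := le_trans (by positivity) hcoer
  have hTv : Tv ≤ μ⁻¹ * (Dv - γ * Av) := by
    rw [inv_mul_eq_div, le_div_iff₀ hμ]
    linarith
  calc Tu ≤ t * Tv := hTT
    _ ≤ t * (μ⁻¹ * ((1 + (t - 1) * M) * (Du - γ * Au))) := by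
        refine mul_le_mul_of_nonneg_left (hTv.trans ?_) ht0.le
        exact mul_le_mul_of_nonneg_left hQ (inv_nonneg.2 hμ.le)
    _ = t * (μ⁻¹ * (1 + (t - 1) * M)) * (Du - γ * Au) := by ring
    _ ≤ (μ⁻¹ + ε) * (Du - γ * Au) := mul_le_mul_of_nonneg_right hl2.le hQ0

/-! ### Away from the origin, and globalization -/

/-- Young's inequality with an arbitrarily small coefficient `a` on one side. -/
theorem rpow_mul_rpow_le_add {a θ : ℝ} (ha : 0 < a) (hθ : 0 < θ) (hθ1 : θ ≤ 1) {A B : ℝ}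
    (hA : 0 ≤ A) (hB : 0 ≤ B) :
    A ^ θ * B ^ (1 - θ) ≤ a ^ (-((1 - θ) / θ)) * A + a * B := by
  set M := a ^ (-((1 - θ) / θ)) with hM
  have hM0 : 0 < M := Real.rpow_pos_of_pos ha _
  have h1 : M ^ θ * a ^ (1 - θ) = 1 := by
    rw [hM, ← Real.rpow_mul ha.le, ← Real.rpow_add ha]
    have : -((1 - θ) / θ) * θ + (1 - θ) = 0 := by field_simp; ring
    rw [this, Real.rpow_zero]
  have h2 := Real.geom_mean_le_arith_mean2_weighted hθ.le (sub_nonneg.2 hθ1)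
    (mul_nonneg hM0.le hA) (mul_nonneg ha.le hB) (by ring)
  rw [Real.mul_rpow hM0.le hA, Real.mul_rpow ha.le hB] at h2
  have hMA : 0 ≤ M * A := mul_nonneg hM0.le hA
  have haB : 0 ≤ a * B := mul_nonneg ha.le hB
  calc A ^ θ * B ^ (1 - θ) = M ^ θ * A ^ θ * (a ^ (1 - θ) * B ^ (1 - θ)) := by
        calc _ = (M ^ θ * a ^ (1 - θ)) * (A ^ θ * B ^ (1 - θ)) := by rw [h1, one_mul]
          _ = _ := by ring
    _ ≤ θ * (M * A) + (1 - θ) * (a * B) := h2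
    _ ≤ M * A + a * B := by nlinarith

theorem IsTestFunction.integral_sq_div_le_of_eqOn_ball {W : Set (EuclideanSpace ℝ (Fin n))}
    (hW : (0 : EuclideanSpace ℝ (Fin n)) ∉ W) {u : EuclideanSpace ℝ (Fin n) → ℝ}
    (hu : IsTestFunction W u) {r : ℝ} (hr : 0 < r) (h0 : ∀ x ∈ Metric.closedBall 0 r, u x = 0) :
    ∫ x, u x ^ 2 / ‖x‖ ^ 2 ≤ (r ^ 2)⁻¹ * ∫ x, u x ^ 2 := by
  rw [← integral_const_mul]
  refine integral_mono (hu.integrable_sq_div hW) (hu.integrable_sq.const_mul _) fun x => ?_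
  by_cases hx : x ∈ Metric.closedBall (0 : EuclideanSpace ℝ (Fin n)) r
  · simp [h0 x hx]
  · have h1 : r ≤ ‖x‖ := by
      rw [mem_closedBall_zero_iff, not_le] at hx
      exact hx.le
    simp only
    rw [div_eq_inv_mul]
    gcongr

/-- Away from `0` the problem is subcritical if `s > 0`; if `s = 0` the best constant of the
half-space is at most the Sobolev constant. -/
theorem exists_inequality_away_from_zero [NeZero n] (hn : 3 ≤ n) {γ s : ℝ}
    (hγ : γ < (n : ℝ) ^ 2 / 4) (hs : s ∈ Set.Icc (0 : ℝ) 2) {ε r : ℝ} (hε : 0 < ε) (hr : 0 < r) :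
    ∃ C : ℝ, 0 ≤ C ∧ ∀ (W : Set (EuclideanSpace ℝ (Fin n))) (u : EuclideanSpace ℝ (Fin n) → ℝ),
      (0 : EuclideanSpace ℝ (Fin n)) ∉ W → IsTestFunction W u →
      (∀ x ∈ Metric.closedBall 0 r, u x = 0) →
      hardySobolevTerm s Set.univ u ≤ ((bestConstant γ s (halfSpace n))⁻¹ + ε) *
        (∫ x, ‖gradient u x‖ ^ 2) + C * ∫ x, u x ^ 2 := by
  have hμ := bestConstant_halfSpace_pos hn hγ hs
  rcases hs.1.eq_or_lt with rfl | hs0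
  · refine ⟨0, le_rfl, fun W u hW hu h0 => ?_⟩
    have hD : 0 ≤ ∫ x, ‖gradient u x‖ ^ 2 := integral_nonneg fun x => by positivity
    have h1 := hu.bestConstant_mul_le_of_zero hn hγ
    rw [mul_comm, ← le_div_iff₀ hμ, div_eq_inv_mul] at h1
    rw [zero_mul, add_zero, add_mul]
    exact h1.trans (le_add_of_nonneg_right (mul_nonneg hε.le hD))
  · obtain ⟨S, hS, hSob⟩ := exists_sobolev hn
    have hq := critExp_pos hn hs.2
    have hθ : 0 < s / critExp n s := div_pos hs0 hq
    have hθ1 : s / critExp n s ≤ 1 := by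
      rw [div_le_one hq]
      exact hs.2.trans (two_le_critExp hn hs.2)
    set M := (ε / S) ^ (-((1 - s / critExp n s) / (s / critExp n s))) with hM
    have hM0 : 0 < M := Real.rpow_pos_of_pos (by positivity) _
    refine ⟨M * (r ^ 2)⁻¹, by positivity, fun W u hW hu h0 => ?_⟩
    have hD : 0 ≤ ∫ x, ‖gradient u x‖ ^ 2 := integral_nonneg fun x => by positivity
    have hA : 0 ≤ ∫ x, u x ^ 2 / ‖x‖ ^ 2 := integral_nonneg fun x => by positivity
    calc hardySobolevTerm s Set.univ u
        ≤ M * (∫ x, u x ^ 2 / ‖x‖ ^ 2) + ε / S * hardySobolevTerm 0 Set.univ u :=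
          (hu.hardySobolevTerm_le hn hs hW).trans (rpow_mul_rpow_le_add (by positivity) hθ hθ1 hA
            (hardySobolevTerm_nonneg _ _ _))
      _ ≤ M * ((r ^ 2)⁻¹ * ∫ x, u x ^ 2) + ε / S * (S * ∫ x, ‖gradient u x‖ ^ 2) :=
          add_le_add
            (mul_le_mul_of_nonneg_left (hu.integral_sq_div_le_of_eqOn_ball hW hr h0) hM0.le)
            (mul_le_mul_of_nonneg_left (hSob W u hu) (by positivity))
      _ = ε * (∫ x, ‖gradient u x‖ ^ 2) + M * (r ^ 2)⁻¹ * ∫ x, u x ^ 2 := by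
          field_simp
          ring
      _ ≤ _ := by
          rw [add_mul (_)⁻¹]
          have := mul_nonneg (inv_nonneg.2 hμ.le) hD
          linarith

/-- The localization identity for the quadratic partition of unity `(sin θ, cos θ)`. -/
theorem norm_gradient_sin_mul_sq_add {θ u : EuclideanSpace ℝ (Fin n) → ℝ}
    {x : EuclideanSpace ℝ (Fin n)} (hθ : DifferentiableAt ℝ θ x) (hu : DifferentiableAt ℝ u x) :
    ‖gradient (fun y => Real.sin (θ y) * u y) x‖ ^ 2 +
      ‖gradient (fun y => Real.cos (θ y) * u y) x‖ ^ 2 =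
    ‖gradient u x‖ ^ 2 + u x ^ 2 * ‖gradient θ x‖ ^ 2 := by
  have h1 : gradient (fun y => Real.sin (θ y) * u y) x =
      Real.sin (θ x) • gradient u x + (u x * Real.cos (θ x)) • gradient θ x := by
    rw [gradient, (hθ.hasFDerivAt.sin.fun_mul hu.hasFDerivAt).fderiv]
    simp [gradient, smul_smul]
  have h2 : gradient (fun y => Real.cos (θ y) * u y) x =
      Real.cos (θ x) • gradient u x - (u x * Real.sin (θ x)) • gradient θ x := by
    rw [gradient, (hθ.hasFDerivAt.cos.fun_mul hu.hasFDerivAt).fderiv]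
    simp [gradient, smul_smul, sub_eq_add_neg]
  rw [h1, h2, norm_add_sq_real, norm_sub_sq_real]
  simp only [norm_smul, mul_pow, Real.norm_eq_abs, sq_abs, inner_smul_left, inner_smul_right,
    abs_mul, conj_trivial]
  linear_combination (‖gradient u x‖ ^ 2 + u x ^ 2 * ‖gradient θ x‖ ^ 2) *
    Real.sin_sq_add_cos_sq (θ x)

/-- The inequality for test functions on `Ω`. -/
theorem SmoothBoundaryAtZero.exists_inequality [NeZero n] (hn : 3 ≤ n) {γ s : ℝ}
    (hγ : γ < (n : ℝ) ^ 2 / 4) (hs : s ∈ Set.Icc (0 : ℝ) 2)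
    {Ω : Set (EuclideanSpace ℝ (Fin n))} (hΩ : SmoothBoundaryAtZero Ω) (hΩo : IsOpen Ω)
    (h0Ω : (0 : EuclideanSpace ℝ (Fin n)) ∉ Ω) {ε : ℝ} (hε : 0 < ε) :
    ∃ C : ℝ, 0 < C ∧ ∀ u : EuclideanSpace ℝ (Fin n) → ℝ, IsTestFunction Ω u →
      hardySobolevTerm s Set.univ u ≤ ((bestConstant γ s (halfSpace n))⁻¹ + ε) *
        ((∫ x, ‖gradient u x‖ ^ 2) - γ * ∫ x, u x ^ 2 / ‖x‖ ^ 2) + C * ∫ x, u x ^ 2 := by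
  obtain ⟨δ, hδ, hloc⟩ := hΩ.exists_local_inequality hn hγ hs hΩo h0Ω hε
  let b : ContDiffBump (0 : EuclideanSpace ℝ (Fin n)) :=
    ⟨δ / 4, δ / 2, by positivity, by linarith⟩
  have hr : 0 < δ / 4 := by positivity
  obtain ⟨C₂, hC₂, hfar⟩ := exists_inequality_away_from_zero hn hγ hs hε hr
  set m := (bestConstant γ s (halfSpace n))⁻¹ + ε with hm
  have hm0 : 0 < m := add_pos (inv_pos.2 (bestConstant_halfSpace_pos hn hγ hs)) hε
  let θ : EuclideanSpace ℝ (Fin n) → ℝ := fun x => Real.pi / 2 * b x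
  have hθ : IsTestFunction Set.univ θ :=
    ⟨contDiff_const.mul b.contDiff, b.hasCompactSupport.mul_left, Set.subset_univ _⟩
  obtain ⟨B, hB⟩ := hθ.continuous_gradient.bounded_above_of_compact_support
    (hθ.hasCompactSupport.mono' fun x hx => by
      by_contra h
      exact hx (IsTestFunction.gradient_eq_zero h))
  have hη₁ : ContDiff ℝ ∞ fun x => Real.sin (θ x) := hθ.contDiff.sin
  have hη₂ : ContDiff ℝ ∞ fun x => Real.cos (θ x) := hθ.contDiff.cos
  refine ⟨m * (B ^ 2 + |γ| * ((δ / 4) ^ 2)⁻¹) + C₂ + 1, by positivity, fun u hu => ?_⟩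
  have hu₁ := hu.mul_left hη₁
  have hu₂ := hu.mul_left hη₂
  have hT := hu.hardySobolevTerm_le_add hn hs h0Ω hη₁ hη₂ fun x => Real.sin_sq_add_cos_sq (θ x)
  have h₁ := hloc _ hu₁ (by
    have h1 : tsupport (fun x => Real.sin (θ x) * u x) ⊆ tsupport b := by
      refine closure_mono fun x hx hbx => hx ?_
      simp [θ, hbx]
    refine h1.trans ?_
    rw [b.tsupport_eq]
    exact Metric.closedBall_subset_ball (by show δ / 2 < δ; linarith))
  have hz₂ : ∀ x ∈ Metric.closedBall 0 (δ / 4), Real.cos (θ x) * u x = 0 := by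
    intro x hx
    have : b x = 1 := b.one_of_mem_closedBall hx
    simp [θ, this]
  have h₂ := hfar Ω _ h0Ω hu₂ hz₂
  have hA₂ := hu₂.integral_sq_div_le_of_eqOn_ball h0Ω hr hz₂
  have hI₂ : ∫ x, (Real.cos (θ x) * u x) ^ 2 ≤ ∫ x, u x ^ 2 :=
    integral_mono hu₂.integrable_sq hu.integrable_sq fun x => by
      simp only [mul_pow]
      exact mul_le_of_le_one_left (sq_nonneg _) (Real.cos_sq_le_one _)
  have hA : (∫ x, (Real.sin (θ x) * u x) ^ 2 / ‖x‖ ^ 2) +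
      ∫ x, (Real.cos (θ x) * u x) ^ 2 / ‖x‖ ^ 2 = ∫ x, u x ^ 2 / ‖x‖ ^ 2 := by
    rw [← integral_add (hu₁.integrable_sq_div h0Ω) (hu₂.integrable_sq_div h0Ω)]
    refine integral_congr_ae (ae_of_all _ fun x => ?_)
    simp only
    rw [← add_div, mul_pow, mul_pow, ← add_mul, Real.sin_sq_add_cos_sq, one_mul]
  have hD : (∫ x, ‖gradient (fun y => Real.sin (θ y) * u y) x‖ ^ 2) +
      ∫ x, ‖gradient (fun y => Real.cos (θ y) * u y) x‖ ^ 2 ≤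
      (∫ x, ‖gradient u x‖ ^ 2) + B ^ 2 * ∫ x, u x ^ 2 := by
    rw [← integral_add hu₁.integrable_norm_gradient_sq hu₂.integrable_norm_gradient_sq,
      ← integral_const_mul, ← integral_add hu.integrable_norm_gradient_sq
        (hu.integrable_sq.const_mul _)]
    refine integral_mono
      (hu₁.integrable_norm_gradient_sq.add hu₂.integrable_norm_gradient_sq)
      (hu.integrable_norm_gradient_sq.add (hu.integrable_sq.const_mul _)) fun x => ?_
    simp only
    rw [norm_gradient_sin_mul_sq_add (hθ.differentiable x) (hu.differentiable x),
      mul_comm (B ^ 2)]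
    have := pow_le_pow_left₀ (norm_nonneg _) (hB x) 2
    gcongr
  have hI : 0 ≤ ∫ x, u x ^ 2 := integral_nonneg fun x => sq_nonneg _
  have hA₂0 : 0 ≤ ∫ x, (Real.cos (θ x) * u x) ^ 2 / ‖x‖ ^ 2 :=
    integral_nonneg fun x => by positivity
  set I := ∫ x, u x ^ 2
  set A₁ := ∫ x, (Real.sin (θ x) * u x) ^ 2 / ‖x‖ ^ 2
  set A₂ := ∫ x, (Real.cos (θ x) * u x) ^ 2 / ‖x‖ ^ 2
  set A := ∫ x, u x ^ 2 / ‖x‖ ^ 2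
  set D₁ := ∫ x, ‖gradient (fun y => Real.sin (θ y) * u y) x‖ ^ 2
  set D₂ := ∫ x, ‖gradient (fun y => Real.cos (θ y) * u y) x‖ ^ 2
  set D := ∫ x, ‖gradient u x‖ ^ 2
  have hγA₂ : γ * A₂ ≤ |γ| * (((δ / 4) ^ 2)⁻¹ * I) :=
    calc γ * A₂ ≤ |γ| * A₂ := mul_le_mul_of_nonneg_right (le_abs_self γ) hA₂0
      _ ≤ _ := mul_le_mul_of_nonneg_left (hA₂.trans
        (mul_le_mul_of_nonneg_left hI₂ (by positivity))) (abs_nonneg γ)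
  have hsum : (D₁ - γ * A₁) + D₂ ≤ (D - γ * A) + (B ^ 2 + |γ| * ((δ / 4) ^ 2)⁻¹) * I := by
    have : γ * A = γ * A₁ + γ * A₂ := by rw [← hA, mul_add]
    linarith
  have h3 := mul_le_mul_of_nonneg_left hsum hm0.le
  have h4 := mul_le_mul_of_nonneg_left hI₂ hC₂
  linarith

end HardySchrodinger

theorem mainTheorem6 (n : ℕ) [NeZero n] (hn : 3 ≤ n) (γ s : ℝ)
    (hγ : γ < (n : ℝ) ^ 2 / 4) (hs : s ∈ Set.Icc (0 : ℝ) 2)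
    (Ω : Set (EuclideanSpace ℝ (Fin n)))
    (hΩ_open : IsOpen Ω) (hΩ_conn : IsConnected Ω) (hΩ_bdd : Bornology.IsBounded Ω)
    (h0 : (0 : EuclideanSpace ℝ (Fin n)) ∈ frontier Ω)
    (hΩ_smooth : HardySchrodinger.SmoothBoundaryAtZero Ω) :
    0 < HardySchrodinger.bestConstant γ s (HardySchrodinger.halfSpace n) ∧
    ∀ ε : ℝ, 0 < ε → ∃ C : ℝ, 0 < C ∧
      ∀ (u : EuclideanSpace ℝ (Fin n) → ℝ)
        (G : EuclideanSpace ℝ (Fin n) → EuclideanSpace ℝ (Fin n)),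
        HardySchrodinger.MemD12 Ω u → HardySchrodinger.HasWeakGradientOn Ω u G →
        IntegrableOn (fun x => |u x| ^ HardySchrodinger.critExp n s / ‖x‖ ^ s) Ω ∧
        IntegrableOn (fun x => ‖G x‖ ^ 2) Ω ∧
        IntegrableOn (fun x => u x ^ 2 / ‖x‖ ^ 2) Ω ∧
        IntegrableOn (fun x => u x ^ 2) Ω ∧
        (∫ x in Ω, |u x| ^ HardySchrodinger.critExp n s / ‖x‖ ^ s)
            ^ (2 / HardySchrodinger.critExp n s) ≤
          ((HardySchrodinger.bestConstant γ s (HardySchrodinger.halfSpace n))⁻¹ + ε) *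
              (∫ x in Ω, (‖G x‖ ^ 2 - γ * (u x ^ 2 / ‖x‖ ^ 2))) +
            C * ∫ x in Ω, u x ^ 2 := by
  have h0Ω : (0 : EuclideanSpace ℝ (Fin n)) ∉ Ω := by
    rw [hΩ_open.frontier_eq] at h0
    exact h0.2
  refine ⟨HardySchrodinger.bestConstant_halfSpace_pos hn hγ hs, fun ε hε => ?_⟩
  obtain ⟨C, hC, hineq⟩ := hΩ_smooth.exists_inequality hn hγ hs hΩ_open h0Ω hε
  refine ⟨C, hC, fun u G hu hG => ?_⟩
  obtain ⟨φ, hφ, hT, hA, hD, hI⟩ := hu.exists_approximation hn hΩ_open h0Ω hG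
  have hI := hI hΩ_bdd
  refine ⟨(hT s hs).1, hD.1, hA.1, hI.1, ?_⟩
  have hq := HardySchrodinger.critExp_pos hn hs.2
  rw [integral_sub hD.1 (hA.1.const_mul γ), integral_const_mul]
  refine le_of_tendsto_of_tendsto'
    ((hT s hs).2.rpow_const (p := 2 / HardySchrodinger.critExp n s) (Or.inr (by positivity)))
    (((hD.2.sub (hA.2.const_mul γ)).const_mul _).add (hI.2.const_mul C)) fun k => ?_
  simpa only [HardySchrodinger.hardySobolevTerm, Measure.restrict_univ] using hineq _ (hφ k)
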